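/- Let $\mathbb{T}^2=(\mathbb{R}/\mathbb{Z})\times(\mathbb{R}/\mathbb{Z})$ be the torus. Let $M$ be a connected sum $\mathbb{T}^2\#\mathbb{T}^2$ (the two-holed torus), that is, a topological space homeomorphic to one obtained as follows: choose open embeddings $e_1,e_2:\mathbb{R}^2\to\mathbb{T}^2$ and a homeomorphism $\varphi:S^1\to S^1$ of the unit circle, remove from the $i$-th copy of $\mathbb{T}^2$ the open disc $e_i(\{|z|<1\})$ $(i=1,2)$, and glue the two remaining spaces along their boundary circles by identifying $e_1(z)$ with $e_2(\varphi(z))$ for every $z\in S^1$. Then for every base point $x_0\in M$, $$\pi_1(M,x_0)\;\cong\;\big\langle \alpha_1,\beta_1,\alpha_2,\beta_2 \;\big|\; [\alpha_1,\beta_1][\alpha_2,\beta_2]\big\rangle,\qquad\text{where } [\alpha_i,\beta_i]=\beta_i\alpha_i\beta_i^{-1}\alpha_i^{-1}.$$ -/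

import Mathlib

open Topology

/-- A regular coordinate ball in an `n`-dimensional space `X`: an open coordinate patch
`ℝⁿ → X`. The open ball it singles out is the image of the open unit ball of `ℝⁿ`; since the
coordinates extend beyond the closed unit ball, the boundary of that ball is the image of the unit
sphere. -/
structure RegularBall (n : ℕ) (X : Type*) [TopologicalSpace X] where
  /-- The coordinate patch. -/
  toFun : EuclideanSpace ℝ (Fin n) → X
  isOpenEmbedding : IsOpenEmbedding toFun

namespace RegularBall

variable {n : ℕ} {X : Type*} [TopologicalSpace X]

/-- What is left of `X` when the open ball is removed, as a subset of `X`. -/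
def complement (e : RegularBall n X) : Set X :=
  (e.toFun '' Metric.ball 0 1)ᶜ

theorem apply_mem_complement (e : RegularBall n X)
    (z : Metric.sphere (0 : EuclideanSpace ℝ (Fin n)) 1) : e.toFun z ∈ e.complement := by
  rintro ⟨w, hw, h⟩
  have hwz : w = z := e.isOpenEmbedding.injective h
  have hz := z.2
  rw [hwz, Metric.mem_ball] at hw
  rw [Metric.mem_sphere] at hz
  exact absurd hz hw.ne

/-- The parametrized boundary sphere of the removed ball. -/
def boundary (e : RegularBall n X) (z : Metric.sphere (0 : EuclideanSpace ℝ (Fin n)) 1) :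
    e.complement :=
  ⟨e.toFun z, e.apply_mem_complement z⟩

end RegularBall

section ConnectedSum

variable {n : ℕ} {X Y : Type*} [TopologicalSpace X] [TopologicalSpace Y]

/-- The identification of the two boundary spheres along a homeomorphism `φ` of the sphere. -/
inductive GlueRel (e : RegularBall n X) (f : RegularBall n Y)
    (φ : Metric.sphere (0 : EuclideanSpace ℝ (Fin n)) 1 ≃ₜ
      Metric.sphere (0 : EuclideanSpace ℝ (Fin n)) 1) :
    e.complement ⊕ f.complement → e.complement ⊕ f.complement → Prop
  | glue (z : Metric.sphere (0 : EuclideanSpace ℝ (Fin n)) 1) :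
      GlueRel e f φ (Sum.inl (e.boundary z)) (Sum.inr (f.boundary (φ z)))

/-- The space obtained by removing an open ball from each of `X` and `Y` and gluing the boundary
spheres along `φ`, with the quotient topology. (`Quot` divides by the equivalence relation
generated by `GlueRel`.) -/
abbrev GluedSum (e : RegularBall n X) (f : RegularBall n Y)
    (φ : Metric.sphere (0 : EuclideanSpace ℝ (Fin n)) 1 ≃ₜ
      Metric.sphere (0 : EuclideanSpace ℝ (Fin n)) 1) : Type _ :=
  Quot (GlueRel e f φ)

end ConnectedSum

/-- `M` is (homeomorphic to) a connected sum of the `n`-dimensional spaces `X` and `Y`, for some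
choice of the removed balls and of the gluing homeomorphism. -/
def IsConnectedSum (n : ℕ) (M X Y : Type*) [TopologicalSpace M] [TopologicalSpace X]
    [TopologicalSpace Y] : Prop :=
  ∃ (e : RegularBall n X) (f : RegularBall n Y)
    (φ : Metric.sphere (0 : EuclideanSpace ℝ (Fin n)) 1 ≃ₜ
      Metric.sphere (0 : EuclideanSpace ℝ (Fin n)) 1),
    Nonempty (M ≃ₜ GluedSum e f φ)

/-- The torus `(ℝ/ℤ) × (ℝ/ℤ)`. -/
abbrev Torus : Type := UnitAddCircle × UnitAddCircle

/-- The four generators. -/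
inductive TwoHoledGen : Type
  | α₁ | β₁ | α₂ | β₂

/-- The relator `[α₁, β₁][α₂, β₂]`, where `[α, β] = β α β⁻¹ α⁻¹`. -/
def twoHoledRelator : FreeGroup TwoHoledGen :=
  let α₁ := FreeGroup.of TwoHoledGen.α₁
  let β₁ := FreeGroup.of TwoHoledGen.β₁
  let α₂ := FreeGroup.of TwoHoledGen.α₂
  let β₂ := FreeGroup.of TwoHoledGen.β₂
  (β₁ * α₁ * β₁⁻¹ * α₁⁻¹) * (β₂ * α₂ * β₂⁻¹ * α₂⁻¹)

open unitInterval commutatorElement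

/-!
The fundamental group of a punctured torus is free on two generators, and the boundary of the
standard patch around the puncture represents their commutator. Near the center of two embedded
patches each patch contains a small circle of the other, so their boundary loops generate conjugate
cyclic subgroups. Since free groups are torsion-free, the boundary of an arbitrary patch is thus
conjugate to the commutator or to its inverse, and exchanging the generators inverts the commutator:
in a suitable basis the boundary is the commutator itself.

Turning a patch inside out by `z ↦ φ(z / |z|) / |z|` exhibits the glued space as the union of two
open punctured tori that meet in a punctured plane, and the presentation follows by van Kampen.

A homomorphism out of a fundamental group is handled as a path cocycle, a multiplicative and
homotopy-invariant function on all paths. Cocycles on two open sets that agree on the overlap are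
glued as follows: pulled back to an interval or a square they have primitives near each point,
unique up to translation, and these patch together because a covering space of a simply connected
space has a section.
-/

section Translates

variable {K G ι : Type*} [TopologicalSpace K] [Group G]

/-- Near the point `x`, the functions `g` and `h` differ by a right translation of the group. Two
primitives of the same path cocycle are related in this way. -/
def IsTranslateNear (x : K) (g h : K → G) : Prop :=
  ∃ c, ∀ᶠ y in 𝓝 x, h y = g y * c

/-- The principal bundle with discrete structure group whose sections over the sets `N i` are the
translates of the functions `g i`. -/
def translateBundle [TopologicalSpace G] [DiscreteTopology G] {N : ι → Set K} {g : ι → K → G}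
    {index : K → ι} (hN : ∀ i, IsOpen (N i)) (hindex : ∀ x, x ∈ N (index x))
    (hg : ∀ i j, ∀ x ∈ N i ∩ N j, IsTranslateNear x (g i) (g j)) :
    FiberBundleCore ι K G where
  baseSet := N
  isOpen_baseSet := hN
  indexAt := index
  mem_baseSet_at := hindex
  coordChange i j x v := (g j x)⁻¹ * g i x * v
  coordChange_self i x _ v := by group
  coordChange_comp i j k x _ v := by group
  continuousOn_coordChange i j := by
    rintro ⟨x, v⟩ ⟨hx, -⟩
    obtain ⟨c, hc⟩ := hg i j x hx
    refine ContinuousAt.continuousWithinAt ?_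
    refine (continuousAt_const.mul continuousAt_snd : ContinuousAt (fun p : K × G => c⁻¹ * p.2)
      (x, v)).congr ?_
    filter_upwards [continuousAt_fst.eventually hc] with p hp
    simp [hp]

theorem exists_forall_isTranslateNear [SimplyConnectedSpace K] [LocallyPathConnectedSpace K]
    {N : ι → Set K} {g : ι → K → G} (hN : ∀ i, IsOpen (N i)) (hcov : ∀ x, ∃ i, x ∈ N i)
    (hg : ∀ i j, ∀ x ∈ N i ∩ N j, IsTranslateNear x (g i) (g j)) :
    ∃ h : K → G, ∀ i, ∀ x ∈ N i, IsTranslateNear x (g i) h := by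
  let : TopologicalSpace G := ⊥
  have : DiscreteTopology G := ⟨rfl⟩
  choose index hindex using hcov
  let B := translateBundle hN hindex hg
  obtain ⟨x₀⟩ : Nonempty K := inferInstance
  obtain ⟨s, ⟨-, hs⟩, -⟩ := (FiberBundle.isCoveringMap (F := G) (E := B.Fiber)
    ).existsUnique_continuousMap_lifts (ContinuousMap.id K) x₀ ⟨x₀, (1 : G)⟩ rfl
  have hs' : ∀ x, (s x).proj = x := congrFun hs
  let v : K → G := fun x => (s x).2
  refine ⟨fun x => g (index x) x * v x, fun i x hx => ?_⟩
  have hcoord : ∀ y, (B.localTriv i (s y)).2 = (g i y)⁻¹ * (g (index y) y * v y) := fun y => by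
    rw [← mul_assoc]
    exact congrArg (fun z => (g i z)⁻¹ * g (index z) z * v y) (hs' y)
  have hcont : ContinuousAt (fun y => (B.localTriv i (s y)).2) x :=
    continuousAt_snd.comp
      (((B.localTriv i).continuousAt <| (B.mem_localTriv_source i _).mpr
        (by rwa [hs' x])).comp s.continuous.continuousAt)
  refine ⟨(B.localTriv i (s x)).2, ?_⟩
  filter_upwards [hcont.eventually (mem_nhds_discrete.mpr rfl :
    {(B.localTriv i (s x)).2} ∈ 𝓝 _)] with y hy
  rw [← Set.mem_singleton_iff.mp hy, hcoord, mul_inv_cancel_left]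

end Translates

/-- A group-valued function on the paths of a space that is multiplicative under concatenation and
invariant under homotopy relative to the end points, i.e. a functor from the fundamental groupoid to
a group. Paths are not bundled with their end points; the order of the factors is the one of the
composition in `FundamentalGroup`. -/
@[ext]
structure PathCocycle (X G : Type*) [TopologicalSpace X] [Group G] where
  /-- The value on a path. -/
  toFun : C(I, X) → G
  map_trans' {x y z : X} (p : Path x y) (q : Path y z) :
    toFun (p.trans q).toContinuousMap = toFun q.toContinuousMap * toFun p.toContinuousMap
  map_homotopic' {x y : X} {p q : Path x y} :
    p.Homotopic q → toFun p.toContinuousMap = toFun q.toContinuousMap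

namespace PathCocycle

variable {X Y G : Type*} [TopologicalSpace X] [TopologicalSpace Y] [Group G]

instance : CoeFun (PathCocycle X G) fun _ => C(I, X) → G := ⟨toFun⟩

theorem map_trans (F : PathCocycle X G) {x y z : X} (p : Path x y) (q : Path y z) :
    F (p.trans q).toContinuousMap = F q.toContinuousMap * F p.toContinuousMap :=
  F.map_trans' p q

theorem map_homotopic (F : PathCocycle X G) {x y : X} {p q : Path x y} (h : p.Homotopic q) :
    F p.toContinuousMap = F q.toContinuousMap :=
  F.map_homotopic' h

theorem map_const (F : PathCocycle X G) (x : X) : F (.const I x) = 1 := by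
  have h := F.map_trans (Path.refl x) (Path.refl x)
  rw [F.map_homotopic (Path.Homotopic.refl_trans (Path.refl x))] at h
  exact left_eq_mul.mp h

/-- The pullback of a cocycle along a continuous map. -/
def comap (F : PathCocycle X G) (f : C(Y, X)) : PathCocycle Y G where
  toFun r := F (f.comp r)
  map_trans' p q := by
    have h := F.map_trans (p.map f.continuous) (q.map f.continuous)
    rw [← Path.map_trans] at h
    exact h
  map_homotopic' h := F.map_homotopic (h.map f)

/-- The homomorphism on the fundamental group defined by a cocycle. -/
def hom (F : PathCocycle X G) (x : X) : FundamentalGroup X x →* G where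
  toFun := Quotient.lift (fun p : Path x x => F p.toContinuousMap) fun _ _ h => F.map_homotopic h
  map_one' := F.map_const x
  map_mul' := by
    rintro ⟨p⟩ ⟨q⟩
    exact F.map_trans q p

theorem exists_gauge [SimplyConnectedSpace X] (F : PathCocycle X G) :
    ∃ g : X → G, ∀ r, F r * g (r 0) = g (r 1) := by
  obtain ⟨x₀⟩ : Nonempty X := inferInstance
  refine ⟨fun x => F (PathConnectedSpace.somePath x₀ x).toContinuousMap, fun r => ?_⟩
  let p : Path (r 0) (r 1) := ⟨r, rfl, rfl⟩
  exact (F.map_trans _ p).symm.trans (F.map_homotopic (SimplyConnectedSpace.paths_homotopic _ _))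

end PathCocycle

section UnitInterval

theorem stronglyLocallyContractibleSpace_of_convex {E : Type*} [NormedAddCommGroup E]
    [NormedSpace ℝ E] {s : Set E} (hs : Convex ℝ s) : StronglyLocallyContractibleSpace s := by
  refine .of_bases (fun _ => Metric.nhds_basis_ball) fun x r hr => ?_
  have hball : Subtype.val '' Metric.ball x r = s ∩ Metric.ball (x : E) r :=
    Subtype.image_preimage_val s (Metric.ball x r)
  have : ContractibleSpace (Subtype.val '' Metric.ball x r) := by
    rw [hball]
    exact (hs.inter (convex_ball _ r)).contractibleSpace ⟨x, x.2, Metric.mem_ball_self hr⟩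
  exact (IsEmbedding.subtypeVal.homeomorphImage (Metric.ball x r)).contractibleSpace

instance stronglyLocallyContractibleSpace_unitInterval : StronglyLocallyContractibleSpace I :=
  stronglyLocallyContractibleSpace_of_convex (convex_Icc 0 1)

instance contractibleSpace_unitInterval : ContractibleSpace I :=
  (convex_Icc (0 : ℝ) 1).contractibleSpace ⟨0, by simp⟩

end UnitInterval

namespace PathCocycle

variable {X G : Type*} [TopologicalSpace X] [Group G]

theorem mem_of_local (F : PathCocycle X G) (S : Subgroup G)
    (h : ∀ x, ∃ V ∈ 𝓝 x, ∀ r : C(I, X), (∀ t, r t ∈ V) → F r ∈ S) (r : C(I, X)) : F r ∈ S := by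
  obtain ⟨g, hg⟩ := (F.comap r).exists_gauge
  have hlocal : IsLocallyConstant fun t => (QuotientGroup.mk (g t)⁻¹ : G ⧸ S) := by
    refine (IsLocallyConstant.iff_eventually_eq _).mpr fun t => ?_
    obtain ⟨V, hV, hVS⟩ := h (r t)
    obtain ⟨W, ⟨hW, hWp⟩, hWV⟩ :=
      (path_connected_basis t).mem_iff.mp (r.continuous.continuousAt hV)
    filter_upwards [hW] with u hu
    obtain ⟨p, hp⟩ := hWp.joinedIn t (mem_of_mem_nhds hW) u hu
    have hgp := hg p.toContinuousMap
    simp only [Path.coe_toContinuousMap, p.source, p.target] at hgp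
    rw [QuotientGroup.eq, inv_inv, ← hgp, mul_inv_cancel_right]
    exact hVS (r.comp p.toContinuousMap) fun s => hWV (hp s)
  have hends := QuotientGroup.eq.mp (hlocal.apply_eq_of_preconnectedSpace 1 0)
  have hgr : F r * g 0 = g 1 := hg (ContinuousMap.id I)
  rwa [inv_inv, ← hgr, mul_inv_cancel_right] at hends

end PathCocycle

section Primitive

variable {X G ι K L : Type*} [TopologicalSpace X] [TopologicalSpace K] [TopologicalSpace L]
  [Group G] {U : ι → Set X} {F : ∀ i, PathCocycle (U i) G} {H : C(K, X)} {N N' : Set K}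
  {g g' : K → G}

/-- The function `g` integrates over `N` the pullback along `H` of the cocycles `F i`, which are
defined over the sets `U i`. -/
def IsPrimitiveOn (F : ∀ i, PathCocycle (U i) G) (H : C(K, X)) (N : Set K) (g : K → G) : Prop :=
  ∀ i (q : C(I, K)) (r : C(I, U i)), (∀ t, q t ∈ N) → (∀ t, (r t : X) = H (q t)) →
    F i r * g (q 0) = g (q 1)

/-- The function `g` integrates the pullback along `H` of the cocycles `F i` near each point. -/
def IsLocalPrimitive (F : ∀ i, PathCocycle (U i) G) (H : C(K, X)) (g : K → G) : Prop :=
  ∀ x, ∃ N ∈ 𝓝 x, IsPrimitiveOn F H N g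

/-- Cocycles that agree on the paths lying in two of the sets `U i`. -/
def AreCompatible (F : ∀ i, PathCocycle (U i) G) : Prop :=
  ∀ i j (r : C(I, U i)) (r' : C(I, U j)), (∀ t, (r t : X) = r' t) → F i r = F j r'

theorem IsPrimitiveOn.isLocalPrimitive (h : IsPrimitiveOn F H Set.univ g) :
    IsLocalPrimitive F H g :=
  fun _ => ⟨Set.univ, Filter.univ_mem, h⟩

theorem IsLocalPrimitive.comp (h : IsLocalPrimitive F H g) (f : C(L, K)) :
    IsLocalPrimitive F (H.comp f) (g ∘ f) := fun x => by
  obtain ⟨N, hN, h⟩ := h (f x)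
  exact ⟨f ⁻¹' N, f.continuous.continuousAt hN, fun i q r hq hr => h i (f.comp q) r hq hr⟩

theorem IsPrimitiveOn.isTranslateNear [LocallyPathConnectedSpace K] (h : IsPrimitiveOn F H N g)
    (h' : IsPrimitiveOn F H N' g') {x : K} (hN : N ∈ 𝓝 x) (hN' : N' ∈ 𝓝 x)
    (hU : ∃ i, U i ∈ 𝓝 (H x)) : IsTranslateNear x g g' := by
  obtain ⟨i, hi⟩ := hU
  have hV : N ∩ N' ∩ H ⁻¹' U i ∈ 𝓝 x :=
    Filter.inter_mem (Filter.inter_mem hN hN') (H.continuous.continuousAt hi)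
  obtain ⟨W, ⟨hW, hWp⟩, hWV⟩ := (path_connected_basis x).mem_iff.mp hV
  refine ⟨(g x)⁻¹ * g' x, ?_⟩
  filter_upwards [hW] with y hy
  obtain ⟨p, hp⟩ := hWp.joinedIn x (mem_of_mem_nhds hW) y hy
  let r : C(I, U i) := ⟨fun t => ⟨H (p t), (hWV (hp t)).2⟩, by fun_prop⟩
  have e := h i p.toContinuousMap r (fun t => (hWV (hp t)).1.1) fun t => rfl
  have e' := h' i p.toContinuousMap r (fun t => (hWV (hp t)).1.2) fun t => rfl
  simp only [Path.coe_toContinuousMap, p.source, p.target] at e e'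
  rw [← e, ← e', mul_assoc, mul_inv_cancel_left]

theorem IsLocalPrimitive.mul_inv_eq [PreconnectedSpace K] [LocallyPathConnectedSpace K]
    (hU : ∀ x, ∃ i, U i ∈ 𝓝 x) (h : IsLocalPrimitive F H g) (h' : IsLocalPrimitive F H g')
    (x y : K) : g x * (g y)⁻¹ = g' x * (g' y)⁻¹ := by
  have hlocal : IsLocallyConstant fun x => (g x)⁻¹ * g' x := by
    refine (IsLocallyConstant.iff_eventually_eq _).mpr fun x => ?_
    obtain ⟨N, hN, h⟩ := h x
    obtain ⟨N', hN', h'⟩ := h' x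
    obtain ⟨c, hc⟩ := h.isTranslateNear h' hN hN' (hU (H x))
    filter_upwards [hc] with y hy
    rw [hy, hc.self_of_nhds, inv_mul_cancel_left, inv_mul_cancel_left]
  rw [eq_mul_inv_iff_mul_eq, mul_assoc, hlocal.apply_eq_of_preconnectedSpace y x,
    mul_inv_cancel_left]

theorem AreCompatible.exists_isPrimitiveOn (hF : AreCompatible F) (H : C(K, X)) {N : Set K}
    [SimplyConnectedSpace N] {i : ι} (hi : Set.MapsTo H N (U i)) :
    ∃ g : K → G, IsPrimitiveOn F H N g := by
  obtain ⟨g, hg⟩ := ((F i).comap ⟨hi.restrict H N (U i), by fun_prop⟩).exists_gauge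
  refine ⟨Function.extend Subtype.val g 1, fun j q r hq hr => ?_⟩
  let q' : C(I, N) := ⟨fun t => ⟨q t, hq t⟩, by fun_prop⟩
  have hext : ∀ t, Function.extend Subtype.val g 1 (q t) = g (q' t) := fun t =>
    Subtype.val_injective.extend_apply g 1 (q' t)
  rw [hext, hext, ← hg q']
  exact congrArg (· * g (q' 0)) (hF j i r _ hr)

theorem AreCompatible.exists_isLocalPrimitive [SimplyConnectedSpace K]
    [StronglyLocallyContractibleSpace K] (hU : ∀ x, ∃ i, U i ∈ 𝓝 x) (hF : AreCompatible F)
    (H : C(K, X)) : ∃ g : K → G, IsLocalPrimitive F H g := by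
  have hloc : ∀ x : K, ∃ N ∈ 𝓝 x, ∃ g : K → G, IsPrimitiveOn F H N g := fun x => by
    obtain ⟨i, hi⟩ := hU (H x)
    obtain ⟨N, ⟨hN, hNc⟩, hNU⟩ :=
      (contractible_basis x).mem_iff.mp (H.continuous.continuousAt hi)
    have : ContractibleSpace N := hNc
    exact ⟨N, hN, hF.exists_isPrimitiveOn H hNU⟩
  choose N hN g hg using hloc
  obtain ⟨h, hh⟩ := exists_forall_isTranslateNear (N := fun x => interior (N x)) (g := g)
    (fun _ => isOpen_interior) (fun x => ⟨x, mem_interior_iff_mem_nhds.mpr (hN x)⟩)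
    fun x y z hz => (hg x).isTranslateNear (hg y) (mem_interior_iff_mem_nhds.mp hz.1)
      (mem_interior_iff_mem_nhds.mp hz.2) (hU (H z))
  refine ⟨h, fun x => ?_⟩
  obtain ⟨c, hc⟩ := hh x x (mem_interior_iff_mem_nhds.mpr (hN x))
  refine ⟨_, Filter.inter_mem (hN x) hc, fun i q r hq hr => ?_⟩
  rw [(hq 0).2, (hq 1).2, ← mul_assoc, hg x i q r (fun t => (hq t).1) hr]

theorem IsLocalPrimitive.eq_of_forall_eq [PreconnectedSpace K] [LocallyPathConnectedSpace K]
    (hU : ∀ x, ∃ i, U i ∈ 𝓝 x) (h : IsLocalPrimitive F H g) {x : X} (hH : ∀ t, H t = x) (s t : K) :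
    g s = g t := by
  have hone : IsPrimitiveOn F H Set.univ fun _ => 1 := by
    intro i q r _ hr
    have hr : r = .const I (r 0) := by
      ext t
      exact ((hr t).trans (hH _)).trans ((hr 0).trans (hH _)).symm
    rw [hr, (F i).map_const, one_mul]
  simpa [mul_inv_eq_one] using h.mul_inv_eq hU hone.isLocalPrimitive s t

end Primitive

section Glue

variable {X G ι : Type*} [TopologicalSpace X] [Group G] {U : ι → Set X}
  {F : ∀ i, PathCocycle (U i) G}

/-- The increment over the unit interval of a local primitive along a path `r`. By uniqueness up to
translation it does not depend on the primitive, which makes it a cocycle extending all `F i`. -/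
noncomputable def gluedValue (hU : ∀ x, ∃ i, U i ∈ 𝓝 x) (hF : AreCompatible F) (r : C(I, X)) : G :=
  (hF.exists_isLocalPrimitive hU r).choose 1 * ((hF.exists_isLocalPrimitive hU r).choose 0)⁻¹

theorem IsLocalPrimitive.gluedValue_eq {r : C(I, X)} {g : I → G} (h : IsLocalPrimitive F r g)
    (hU : ∀ x, ∃ i, U i ∈ 𝓝 x) (hF : AreCompatible F) : gluedValue hU hF r = g 1 * (g 0)⁻¹ :=
  (hF.exists_isLocalPrimitive hU r).choose_spec.mul_inv_eq hU h 1 0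

theorem gluedValue_trans (hU : ∀ x, ∃ i, U i ∈ 𝓝 x) (hF : AreCompatible F) {x y z : X}
    (p : Path x y) (q : Path y z) : gluedValue hU hF (p.trans q).toContinuousMap =
      gluedValue hU hF q.toContinuousMap * gluedValue hU hF p.toContinuousMap := by
  obtain ⟨g, hg⟩ := hF.exists_isLocalPrimitive hU (p.trans q).toContinuousMap
  let left : C(I, I) := ⟨fun t => ⟨t / 2, by constructor <;> linarith [t.2.1, t.2.2]⟩, by fun_prop⟩
  let right : C(I, I) :=
    ⟨fun t => ⟨(1 + t) / 2, by constructor <;> linarith [t.2.1, t.2.2]⟩, by fun_prop⟩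
  have hleft : (p.trans q).toContinuousMap.comp left = p.toContinuousMap := by
    ext t
    have h := Path.extend_trans_of_le_half p q (t := t / 2) (by linarith [t.2.2])
    rw [mul_div_cancel₀ _ two_ne_zero, Path.extend_extends'] at h
    exact (Path.extend_extends' (p.trans q) (left t)).symm.trans h
  have hright : (p.trans q).toContinuousMap.comp right = q.toContinuousMap := by
    ext t
    have h := Path.extend_trans_of_half_le p q (t := (1 + t) / 2) (by linarith [t.2.1])
    rw [show 2 * ((1 + (t : ℝ)) / 2) - 1 = t by ring, Path.extend_extends'] at h
    exact (Path.extend_extends' (p.trans q) (right t)).symm.trans h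
  have hp : IsLocalPrimitive F p.toContinuousMap (g ∘ left) := hleft ▸ hg.comp left
  have hq : IsLocalPrimitive F q.toContinuousMap (g ∘ right) := hright ▸ hg.comp right
  rw [hg.gluedValue_eq, hp.gluedValue_eq, hq.gluedValue_eq]
  have h₀ : left 0 = 0 := by ext; simp [left]
  have h₁ : right 1 = 1 := by ext; norm_num [right]
  have hmid : right 0 = left 1 := by ext; simp [left, right]
  simp only [Function.comp_apply, h₀, h₁, hmid]
  group

theorem gluedValue_homotopic (hU : ∀ x, ∃ i, U i ∈ 𝓝 x) (hF : AreCompatible F) {x y : X}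
    {p q : Path x y} (h : p.Homotopic q) :
    gluedValue hU hF p.toContinuousMap = gluedValue hU hF q.toContinuousMap := by
  obtain ⟨H⟩ := h
  obtain ⟨g, hg⟩ := hF.exists_isLocalPrimitive hU H.toContinuousMap
  let row (s : I) : C(I, I × I) := ⟨fun t => (s, t), by fun_prop⟩
  let col (t : I) : C(I, I × I) := ⟨fun s => (s, t), by fun_prop⟩
  have h₀ : H.toContinuousMap.comp (row 0) = p.toContinuousMap := ContinuousMap.ext H.apply_zero
  have h₁ : H.toContinuousMap.comp (row 1) = q.toContinuousMap := ContinuousMap.ext H.apply_one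
  have hsource : g (0, 0) = g (1, 0) :=
    (hg.comp (col 0)).eq_of_forall_eq hU (fun t => H.source t) 0 1
  have htarget : g (0, 1) = g (1, 1) :=
    (hg.comp (col 1)).eq_of_forall_eq hU (fun t => H.target t) 0 1
  have hp : IsLocalPrimitive F p.toContinuousMap (g ∘ row 0) := h₀ ▸ hg.comp (row 0)
  have hq : IsLocalPrimitive F q.toContinuousMap (g ∘ row 1) := h₁ ▸ hg.comp (row 1)
  rw [hp.gluedValue_eq, hq.gluedValue_eq]
  exact congrArg₂ (fun a b => a * b⁻¹) htarget hsource

theorem gluedValue_val_comp (hU : ∀ x, ∃ i, U i ∈ 𝓝 x) (hF : AreCompatible F) (i : ι)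
    (r : C(I, U i)) : gluedValue hU hF (.comp ⟨Subtype.val, continuous_subtype_val⟩ r) = F i r := by
  obtain ⟨g, hg⟩ := ((F i).comap r).exists_gauge
  have hprim : IsPrimitiveOn F (.comp ⟨Subtype.val, continuous_subtype_val⟩ r) Set.univ g := by
    intro j q r' _ hr'
    rw [hF j i r' (r.comp q) hr']
    exact hg q
  rw [hprim.isLocalPrimitive.gluedValue_eq, mul_inv_eq_iff_eq_mul]
  exact (hg (ContinuousMap.id I)).symm

theorem AreCompatible.exists_glue (hU : ∀ x, ∃ i, U i ∈ 𝓝 x) (hF : AreCompatible F) :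
    ∃ Φ : PathCocycle X G, ∀ i (r : C(I, U i)),
      Φ (.comp ⟨Subtype.val, continuous_subtype_val⟩ r) = F i r :=
  ⟨⟨gluedValue hU hF, gluedValue_trans hU hF, gluedValue_homotopic hU hF⟩,
    gluedValue_val_comp hU hF⟩

end Glue

section PathSystems

variable {X Y G : Type*} [TopologicalSpace X] [TopologicalSpace Y] [Group G]

/-- The loop obtained by closing up the path `r` along chosen paths from the base point. -/
noncomputable def closedLoop {x₀ : X} (c : ∀ x, Path x₀ x) (r : C(I, X)) : FundamentalGroup X x₀ :=
  .fromPath (.mk (((c (r 0)).trans ⟨r, rfl, rfl⟩).trans (c (r 1)).symm))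

theorem closedLoop_coe {x₀ x y : X} (c : ∀ x, Path x₀ x) (p : Path x y) :
    closedLoop c p.toContinuousMap = .fromPath (.mk (((c x).trans p).trans (c y).symm)) := by
  obtain ⟨r, rfl, rfl⟩ := p
  rfl

theorem closedLoop_of_refl {x₀ : X} {c : ∀ x, Path x₀ x} (hc : c x₀ = .refl x₀) (p : Path x₀ x₀) :
    closedLoop c p.toContinuousMap = .fromPath (.mk p) := by
  rw [closedLoop_coe, hc, Path.refl_symm]
  exact Path.Homotopic.Quotient.eq.mpr
    ((Path.Homotopic.trans_refl _).trans (Path.Homotopic.refl_trans p))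

theorem closedLoop_trans {x₀ x y z : X} (c : ∀ x, Path x₀ x) (p : Path x y) (q : Path y z) :
    closedLoop c (p.trans q).toContinuousMap =
      closedLoop c q.toContinuousMap * closedLoop c p.toContinuousMap := by
  simp only [closedLoop_coe, FundamentalGroup.mul_def, Path.Homotopic.Quotient.mk_trans,
    Path.Homotopic.Quotient.mk_symm, Path.Homotopic.Quotient.trans_assoc]
  rw [← Path.Homotopic.Quotient.trans_assoc (.symm (.mk (c y))) (.mk (c y)),
    Path.Homotopic.Quotient.symm_trans, Path.Homotopic.Quotient.refl_trans]

theorem closedLoop_comp (f : C(Y, X)) {x₀ : X} {y₀ : Y} (hf : f y₀ = x₀) {c : ∀ x, Path x₀ x}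
    {d : ∀ y, Path y₀ y} (hc : ∀ y t, c (f y) t = f (d y t)) (r : C(I, Y)) :
    closedLoop c (f.comp r) = FundamentalGroup.mapOfEq f hf (closedLoop d r) := by
  subst hf
  have hcd : ∀ y, c (f y) = (d y).map f.continuous := fun y => Path.ext (funext (hc y))
  let p : Path (r 0) (r 1) := ⟨r, rfl, rfl⟩
  refine (closedLoop_coe c (p.map f.continuous)).trans ?_
  rw [hcd, hcd, Path.map_symm, ← Path.map_trans, ← Path.map_trans, FundamentalGroup.mapOfEq_apply,
    Path.Homotopic.Quotient.cast_rfl_rfl]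
  rfl

theorem exists_paths_extending [PathConnectedSpace X] (f : C(Y, X)) (hf : Function.Injective f)
    {y₀ : Y} (d : ∀ y, Path y₀ y) : ∃ c : ∀ x, Path (f y₀) x, ∀ y t, c (f y) t = f (d y t) := by
  have h : ∀ x, ∃ p : Path (f y₀) x, ∀ y, f y = x → ∀ t, p t = f (d y t) := fun x => by
    by_cases hx : ∃ y, f y = x
    · obtain ⟨y, rfl⟩ := hx
      exact ⟨(d y).map f.continuous, fun y' hy' t => by rw [hf hy']; rfl⟩
    · exact ⟨PathConnectedSpace.somePath _ _, fun y hy => (hx ⟨y, hy⟩).elim⟩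
  choose c hc using h
  exact ⟨c, fun y => hc _ y rfl⟩

theorem exists_paths_refl [PathConnectedSpace X] (x₀ : X) :
    ∃ c : ∀ x, Path x₀ x, c x₀ = .refl x₀ := by
  classical
  exact ⟨Function.update (fun x => PathConnectedSpace.somePath x₀ x) x₀ (.refl x₀),
    Function.update_self ..⟩

namespace PathCocycle

/-- The cocycle with values in `G` that evaluates a homomorphism on the closed up paths. -/
noncomputable def ofHom {x₀ : X} (h : FundamentalGroup X x₀ →* G) (c : ∀ x, Path x₀ x) :
    PathCocycle X G where
  toFun r := h (closedLoop c r)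
  map_trans' p q := by rw [closedLoop_trans, map_mul]
  map_homotopic' {x y p q} hpq := by
    rw [closedLoop_coe, closedLoop_coe, Path.Homotopic.Quotient.eq.mpr
      (((Path.Homotopic.refl (c x)).hcomp hpq).hcomp (.refl (c y).symm))]

theorem hom_ofHom {x₀ : X} (h : FundamentalGroup X x₀ →* G) {c : ∀ x, Path x₀ x}
    (hc : c x₀ = .refl x₀) : (ofHom h c).hom x₀ = h := by
  ext ⟨p⟩
  exact congrArg h (closedLoop_of_refl hc p)

theorem comap_ofHom (f : C(Y, X)) {x₀ : X} {y₀ : Y} (hf : f y₀ = x₀)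
    (h : FundamentalGroup X x₀ →* G) {c : ∀ x, Path x₀ x} {d : ∀ y, Path y₀ y}
    (hc : ∀ y t, c (f y) t = f (d y t)) :
    (ofHom h c).comap f = ofHom (h.comp (FundamentalGroup.mapOfEq f hf)) d := by
  ext r
  exact congrArg h (closedLoop_comp f hf hc r)

theorem hom_mapOfEq (F : PathCocycle X G) (f : C(Y, X)) {x : X} {y : Y} (h : f y = x)
    (γ : FundamentalGroup Y y) :
    F.hom x (FundamentalGroup.mapOfEq f h γ) = (F.comap f).hom y γ := by
  subst h
  rw [FundamentalGroup.mapOfEq_apply, Path.Homotopic.Quotient.cast_rfl_rfl]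
  obtain ⟨p⟩ := γ
  rfl

end PathCocycle

end PathSystems

theorem exists_comp_eq {X Y K : Type*} [TopologicalSpace X] [TopologicalSpace Y]
    [TopologicalSpace K] {j : C(Y, X)} (hj : IsEmbedding j) {f : C(K, X)}
    (hf : ∀ x, f x ∈ Set.range j) : ∃ g : C(K, Y), j.comp g = f := by
  choose g hg using hf
  have hjg : j ∘ g = f := funext hg
  exact ⟨⟨g, hj.continuous_iff.mpr (hjg ▸ f.continuous)⟩, ContinuousMap.ext hg⟩

/-- A commutative square exhibiting `X` as the union of two open subspaces `Y₁` and `Y₂` with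
intersection `W`. -/
structure IsOpenSquare {X Y₁ Y₂ W : Type*} [TopologicalSpace X] [TopologicalSpace Y₁]
    [TopologicalSpace Y₂] [TopologicalSpace W] (j₁ : C(Y₁, X)) (j₂ : C(Y₂, X)) (k₁ : C(W, Y₁))
    (k₂ : C(W, Y₂)) : Prop where
  isOpenEmbedding_left : IsOpenEmbedding j₁
  isOpenEmbedding_right : IsOpenEmbedding j₂
  isEmbedding : IsEmbedding k₁
  comm (w : W) : j₁ (k₁ w) = j₂ (k₂ w)
  cover (x : X) : x ∈ Set.range j₁ ∨ x ∈ Set.range j₂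
  overlap {y₁ : Y₁} {y₂ : Y₂} : j₁ y₁ = j₂ y₂ → y₁ ∈ Set.range k₁

namespace IsOpenSquare

variable {X Y₁ Y₂ W G : Type*} [TopologicalSpace X] [TopologicalSpace Y₁] [TopologicalSpace Y₂]
  [TopologicalSpace W] [Group G] {j₁ : C(Y₁, X)} {j₂ : C(Y₂, X)} {k₁ : C(W, Y₁)} {k₂ : C(W, Y₂)}

theorem exists_lift (h : IsOpenSquare j₁ j₂ k₁ k₂) {r₁ : C(I, Y₁)} {r₂ : C(I, Y₂)}
    (hr : ∀ t, j₁ (r₁ t) = j₂ (r₂ t)) : ∃ r : C(I, W), k₁.comp r = r₁ ∧ k₂.comp r = r₂ := by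
  obtain ⟨r, rfl⟩ := exists_comp_eq h.isEmbedding fun t => h.overlap (hr t)
  exact ⟨r, rfl, ContinuousMap.ext fun t =>
    h.isOpenEmbedding_right.injective ((h.comm (r t)).symm.trans (hr t))⟩

theorem nhds_cover (h : IsOpenSquare j₁ j₂ k₁ k₂) (x : X) :
    Set.range j₁ ∈ 𝓝 x ∨ Set.range j₂ ∈ 𝓝 x :=
  (h.cover x).imp h.isOpenEmbedding_left.isOpen_range.mem_nhds
    h.isOpenEmbedding_right.isOpen_range.mem_nhds

theorem pathConnectedSpace (h : IsOpenSquare j₁ j₂ k₁ k₂) [PathConnectedSpace Y₁]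
    [PathConnectedSpace Y₂] [Nonempty W] : PathConnectedSpace X := by
  obtain ⟨w⟩ : Nonempty W := inferInstance
  rw [pathConnectedSpace_iff_univ, ← Set.eq_univ_of_forall h.cover]
  exact (isPathConnected_range j₁.continuous).union (isPathConnected_range j₂.continuous)
    ⟨j₁ (k₁ w), ⟨_, rfl⟩, ⟨k₂ w, (h.comm w).symm⟩⟩

theorem exists_glue (h : IsOpenSquare j₁ j₂ k₁ k₂) {F₁ : PathCocycle Y₁ G} {F₂ : PathCocycle Y₂ G}
    (hF : F₁.comap k₁ = F₂.comap k₂) :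
    ∃ Φ : PathCocycle X G, Φ.comap j₁ = F₁ ∧ Φ.comap j₂ = F₂ := by
  let e₁ := h.isOpenEmbedding_left.toIsEmbedding.toHomeomorph
  let e₂ := h.isOpenEmbedding_right.toIsEmbedding.toHomeomorph
  let U : Bool → Set X := fun i => bif i then Set.range j₂ else Set.range j₁
  let F : ∀ i, PathCocycle (U i) G := fun i => match i with
    | false => F₁.comap (e₁.symm : C(Set.range j₁, Y₁))
    | true => F₂.comap (e₂.symm : C(Set.range j₂, Y₂))
  have hU : ∀ x, ∃ i, U i ∈ 𝓝 x := fun x =>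
    (h.nhds_cover x).elim (fun hx => ⟨false, hx⟩) fun hx => ⟨true, hx⟩
  have hoverlap (r₁ : C(I, Set.range j₁)) (r₂ : C(I, Set.range j₂))
      (hr : ∀ t, (r₁ t : X) = r₂ t) : F false r₁ = F true r₂ := by
    obtain ⟨r, hr₁, hr₂⟩ := h.exists_lift (r₁ := .comp e₁.symm r₁) (r₂ := .comp e₂.symm r₂)
      fun t => (congrArg Subtype.val (e₁.apply_symm_apply (r₁ t))).trans
        ((hr t).trans (congrArg Subtype.val (e₂.apply_symm_apply (r₂ t))).symm)
    change F₁ _ = F₂ _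
    rw [← hr₁, ← hr₂]
    exact congrArg (fun F : PathCocycle W G => F r) hF
  have hcompat : AreCompatible F := by
    rintro (_ | _) (_ | _) r r' hr
    · exact congrArg (F false) (ContinuousMap.ext fun t => Subtype.ext (hr t))
    · exact hoverlap r r' hr
    · exact (hoverlap r' r fun t => (hr t).symm).symm
    · exact congrArg (F true) (ContinuousMap.ext fun t => Subtype.ext (hr t))
  obtain ⟨Φ, hΦ⟩ := hcompat.exists_glue hU
  refine ⟨Φ, PathCocycle.ext (funext fun r => ?_), PathCocycle.ext (funext fun r => ?_)⟩
  · exact (hΦ false (.comp (e₁ : C(Y₁, Set.range j₁)) r)).trans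
      (congrArg F₁ (ContinuousMap.ext fun t => e₁.symm_apply_apply (r t)))
  · exact (hΦ true (.comp (e₂ : C(Y₂, Set.range j₂)) r)).trans
      (congrArg F₂ (ContinuousMap.ext fun t => e₂.symm_apply_apply (r t)))

theorem injective_right (h : IsOpenSquare j₁ j₂ k₁ k₂) : Function.Injective k₂ := fun w w' hw => by
  refine h.isEmbedding.injective (h.isOpenEmbedding_left.injective ?_)
  rw [h.comm, h.comm, hw]

theorem exists_paths (h : IsOpenSquare j₁ j₂ k₁ k₂) {w : W} {d : ∀ w', Path w w'}
    {d₁ : ∀ y, Path (k₁ w) y} {d₂ : ∀ y, Path (k₂ w) y} (hd₁ : ∀ w' t, d₁ (k₁ w') t = k₁ (d w' t))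
    (hd₂ : ∀ w' t, d₂ (k₂ w') t = k₂ (d w' t)) :
    ∃ c : ∀ x, Path (j₁ (k₁ w)) x,
      (∀ y t, c (j₁ y) t = j₁ (d₁ y t)) ∧ ∀ y t, c (j₂ y) t = j₂ (d₂ y t) := by
  have hdj : ∀ y₁ y₂, j₁ y₁ = j₂ y₂ → ∀ t, j₁ (d₁ y₁ t) = j₂ (d₂ y₂ t) := by
    intro y₁ y₂ hy t
    obtain ⟨w', rfl⟩ := h.overlap hy
    obtain rfl := h.isOpenEmbedding_right.injective ((h.comm w').symm.trans hy)
    rw [hd₁, hd₂, h.comm]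
  have hc : ∀ x, ∃ p : Path (j₁ (k₁ w)) x, (∀ y, j₁ y = x → ∀ t, p t = j₁ (d₁ y t)) ∧
      ∀ y, j₂ y = x → ∀ t, p t = j₂ (d₂ y t) := fun x => by
    obtain ⟨y, rfl⟩ | ⟨y, rfl⟩ := h.cover x
    · refine ⟨(d₁ y).map j₁.continuous, fun y' hy t => ?_, fun y' hy => hdj y y' hy.symm⟩
      rw [h.isOpenEmbedding_left.injective hy]
      rfl
    · refine ⟨((d₂ y).map j₂.continuous).cast (h.comm w) rfl, fun y' hy t => (hdj y' y hy t).symm,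
        fun y' hy t => ?_⟩
      rw [h.isOpenEmbedding_right.injective hy]
      rfl
  choose c hc₁ hc₂ using hc
  exact ⟨c, fun y => hc₁ _ y rfl, fun y => hc₂ _ y rfl⟩

variable [PathConnectedSpace Y₁] [PathConnectedSpace Y₂] [PathConnectedSpace W]

theorem exists_cocycle (h : IsOpenSquare j₁ j₂ k₁ k₂) {w : W}
    (h₁ : FundamentalGroup Y₁ (k₁ w) →* G) (h₂ : FundamentalGroup Y₂ (k₂ w) →* G)
    (hW : h₁.comp (FundamentalGroup.mapOfEq k₁ rfl) =
      h₂.comp (FundamentalGroup.mapOfEq k₂ rfl)) :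
    ∃ Φ : PathCocycle X G, (Φ.comap j₁).hom (k₁ w) = h₁ ∧ (Φ.comap j₂).hom (k₂ w) = h₂ := by
  obtain ⟨d, hd⟩ := exists_paths_refl w
  obtain ⟨d₁, hd₁⟩ := exists_paths_extending k₁ h.isEmbedding.injective d
  obtain ⟨d₂, hd₂⟩ := exists_paths_extending k₂ h.injective_right d
  obtain ⟨Φ, hΦ₁, hΦ₂⟩ := h.exists_glue (F₁ := .ofHom h₁ d₁) (F₂ := .ofHom h₂ d₂) <| by
    rw [PathCocycle.comap_ofHom k₁ rfl h₁ hd₁, PathCocycle.comap_ofHom k₂ rfl h₂ hd₂, hW]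
  refine ⟨Φ, ?_, ?_⟩
  · rw [hΦ₁]
    exact PathCocycle.hom_ofHom h₁ (Path.ext (funext fun t => (hd₁ w t).trans (by rw [hd]; rfl)))
  · rw [hΦ₂]
    exact PathCocycle.hom_ofHom h₂ (Path.ext (funext fun t => (hd₂ w t).trans (by rw [hd]; rfl)))

theorem range_sup_range (h : IsOpenSquare j₁ j₂ k₁ k₂) (w : W) :
    (FundamentalGroup.mapOfEq j₁ (x := k₁ w) rfl).range ⊔
      (FundamentalGroup.mapOfEq j₂ (h.comm w).symm).range = ⊤ := by
  obtain ⟨d, hd⟩ := exists_paths_refl w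
  obtain ⟨d₁, hd₁⟩ := exists_paths_extending k₁ h.isEmbedding.injective d
  obtain ⟨d₂, hd₂⟩ := exists_paths_extending k₂ h.injective_right d
  obtain ⟨c, hc₁, hc₂⟩ := h.exists_paths hd₁ hd₂
  have hc : c (j₁ (k₁ w)) = .refl _ :=
    Path.ext (funext fun t => (hc₁ _ t).trans (by rw [hd₁, hd]; rfl))
  suffices hmem : ∀ r : C(I, X), closedLoop c r ∈ _ ⊔ _ by
    refine top_unique fun γ _ => ?_
    obtain ⟨p, rfl⟩ := Path.Homotopic.Quotient.mk_surjective γ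
    have hp := hmem p.toContinuousMap
    rwa [closedLoop_of_refl hc] at hp
  refine (PathCocycle.ofHom (MonoidHom.id _) c).mem_of_local _ fun x => ?_
  rcases h.nhds_cover x with hx | hx
  · refine ⟨_, hx, fun r hr => Subgroup.mem_sup_left ?_⟩
    obtain ⟨r, rfl⟩ := exists_comp_eq h.isOpenEmbedding_left.toIsEmbedding hr
    exact ⟨_, (closedLoop_comp j₁ rfl hc₁ r).symm⟩
  · refine ⟨_, hx, fun r hr => Subgroup.mem_sup_right ?_⟩
    obtain ⟨r, rfl⟩ := exists_comp_eq h.isOpenEmbedding_right.toIsEmbedding hr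
    exact ⟨_, (closedLoop_comp j₂ (h.comm w).symm hc₂ r).symm⟩

end IsOpenSquare

section QuotientCovering

variable {E X A : Type*} [TopologicalSpace E] [TopologicalSpace X] [AddGroup A] [AddAction A E]

theorem zpowers_eq_top_of_lift [SimplyConnectedSpace E] {f : E → X}
    (hf : IsAddQuotientCoveringMap f A) {a : A} (ha : AddSubgroup.zmultiples a = ⊤) {e : E} {x : X}
    (q : Path e (a +ᵥ e)) (p : Path x x) (hqp : ∀ t, f (q t) = p t) :
    Subgroup.zpowers (.fromPath (.mk p) : FundamentalGroup X x) = ⊤ := by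
  obtain rfl : f e = x := by simpa using hqp 0
  let Φ := hf.fundamentalGroupToMulOpposite ⟨e, rfl⟩
  have hp : Φ (.fromPath (.mk p)) = .op (.ofAdd a) := by
    refine hf.fundamentalGroupToMulOpposite_apply_eq_Iff.mpr ?_
    refine congrArg Subtype.val (hf.isCoveringMap.monodromy_eq_of_map_eq (γ := .mk p)
      (ex := ⟨e, rfl⟩) (ey := ⟨a +ᵥ e, ?_⟩) (.mk q) ?_).symm
    · simpa using hqp 1
    · exact congrArg Path.Homotopic.Quotient.mk (Path.ext (funext hqp))
  refine top_unique fun γ _ => ?_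
  obtain ⟨n, hn⟩ : (Φ γ).unop.toAdd ∈ AddSubgroup.zmultiples a := ha ▸ AddSubgroup.mem_top _
  refine ⟨n, hf.fundamentalGroupToMulOpposite_injective ⟨e, rfl⟩ ?_⟩
  change Φ (_ ^ n) = Φ γ
  rw [map_zpow, hp, ← MulOpposite.op_zpow, ← ofAdd_zsmul]
  exact congrArg (fun b => MulOpposite.op (Multiplicative.ofAdd b)) hn

theorem zmultiples_gen_eq_top {G : Type*} [AddGroup G] (g : G) :
    AddSubgroup.zmultiples (⟨g, AddSubgroup.mem_zmultiples g⟩ : AddSubgroup.zmultiples g) = ⊤ :=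
  top_unique fun ⟨_, n, hn⟩ _ => ⟨n, Subtype.ext hn⟩

end QuotientCovering

section PuncturedPlane

/-- The Euclidean plane. -/
abbrev Plane : Type := EuclideanSpace ℝ (Fin 2)

/-- The Euclidean space `ℝⁿ` without the origin. -/
abbrev PuncturedSpace (n : ℕ) : Type := ({0}ᶜ : Set (EuclideanSpace ℝ (Fin n)))

/-- The plane without the origin. -/
abbrev PuncturedPlane : Type := PuncturedSpace 2

instance : PathConnectedSpace PuncturedPlane :=
  isPathConnected_iff_pathConnectedSpace.mp <|
    isPathConnected_compl_singleton_of_one_lt_rank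
      (by rw [← Module.finrank_eq_rank, finrank_euclideanSpace_fin]; norm_num) 0

/-- The standard identification of the complex plane without the origin with the punctured plane. -/
noncomputable def complexPunctured : {z : ℂ // z ≠ 0} ≃ₜ PuncturedPlane :=
  Complex.orthonormalBasisOneI.repr.toHomeomorph.subtype fun z => by simp

theorem norm_complexPunctured (z : {z : ℂ // z ≠ 0}) :
    ‖(complexPunctured z : Plane)‖ = ‖(z : ℂ)‖ :=
  Complex.orthonormalBasisOneI.repr.norm_map z

/-- The curve running with unit speed counterclockwise around the circle through `w`. -/
noncomputable def circleCurve (w : PuncturedPlane) : C(ℝ, PuncturedPlane) where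
  toFun θ := complexPunctured ⟨complexPunctured.symm w * Complex.exp (θ * Complex.I),
    mul_ne_zero (complexPunctured.symm w).2 (Complex.exp_ne_zero _)⟩
  continuous_toFun := by fun_prop

/-- The loop that turns once counterclockwise around the origin, starting at `w`. -/
noncomputable def circleLoop (w : PuncturedPlane) : Path w w where
  toFun t := circleCurve w (2 * Real.pi * t)
  source' := by simp [circleCurve]
  target' := by simp [circleCurve]

theorem norm_circleLoop (w : PuncturedPlane) (t : I) :
    ‖(circleLoop w t : Plane)‖ = ‖(w : Plane)‖ := by
  rw [← complexPunctured.apply_symm_apply w, norm_complexPunctured]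
  refine (norm_complexPunctured _).trans ?_
  rw [norm_mul, Complex.norm_exp_ofReal_mul_I, mul_one, complexPunctured.apply_symm_apply]

theorem zpowers_circleLoop (w : PuncturedPlane) :
    Subgroup.zpowers (.fromPath (.mk (circleLoop w)) : FundamentalGroup PuncturedPlane w) = ⊤ := by
  let z := Complex.log (complexPunctured.symm w)
  refine zpowers_eq_top_of_lift (e := z)
    (Complex.isAddQuotientCoveringMap_exp.homeomorph_comp complexPunctured)
    (zmultiples_gen_eq_top _) ⟨⟨fun t => z + (2 * Real.pi * t : ℝ) * Complex.I, by fun_prop⟩,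
      by simp, by simp [AddSubgroup.vadd_def]; ring⟩ _
    fun t => congrArg complexPunctured (Subtype.ext ?_)
  change Complex.exp (z + _) = _
  rw [Complex.exp_add, Complex.exp_log (complexPunctured.symm w).2]

end PuncturedPlane

section CoveringCocycle

variable {E X G : Type*} [TopologicalSpace E] [TopologicalSpace X] [Group G]

theorem exists_path_lift {p : C(E, X)} (hp : IsCoveringMap p) {e : E} {y : X} (q : Path (p e) y) :
    ∃ (e' : E) (Q : Path e e') (h : p e' = y), q = (Q.map p.continuous).cast rfl h.symm := by
  have hlift := hp.liftPath_lifts q e q.source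
  exact ⟨_, ⟨hp.liftPath q e q.source, hp.liftPath_zero .., rfl⟩,
    (congrFun hlift 1).trans q.target, Path.ext hlift.symm⟩

theorem PathCocycle.exists_of_isCoveringMap {p : C(E, X)} (hp : IsCoveringMap p)
    (hsurj : Function.Surjective p) (k : E → G)
    (hk : ∀ Γ Γ' : C(I, E), p.comp Γ = p.comp Γ' →
      k (Γ 1) * (k (Γ 0))⁻¹ = k (Γ' 1) * (k (Γ' 0))⁻¹) :
    ∃ F : PathCocycle X G, ∀ Γ : C(I, E), F (p.comp Γ) = k (Γ 1) * (k (Γ 0))⁻¹ := by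
  have hlift (r : C(I, X)) : ∃ Γ : C(I, E), p.comp Γ = r := by
    obtain ⟨e, he⟩ := hsurj (r 0)
    obtain ⟨e', Q, _, hQ⟩ := exists_path_lift hp (⟨r, he.symm, rfl⟩ : Path (p e) _)
    exact ⟨Q.toContinuousMap, congrArg Path.toContinuousMap hQ.symm⟩
  choose L hL using hlift
  let value (r : C(I, X)) : G := k (L r 1) * (k (L r 0))⁻¹
  have hvalue {e e' : E} (Q : Path e e') :
      value (Q.map p.continuous).toContinuousMap = k e' * (k e)⁻¹ := by
    exact (hk _ Q.toContinuousMap (hL _)).trans (by simp)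
  refine ⟨⟨value, fun {x y z} q q' => ?_, fun {x y q q'} h => ?_⟩, fun Γ => hk _ _ (hL _)⟩
  · obtain ⟨e, rfl⟩ := hsurj x
    obtain ⟨e', Q, rfl, rfl⟩ := exists_path_lift hp q
    obtain ⟨e'', Q', rfl, rfl⟩ := exists_path_lift hp q'
    rw [Path.cast_rfl_rfl, Path.cast_rfl_rfl, ← Path.map_trans, hvalue, hvalue, hvalue]
    group
  · obtain ⟨e, rfl⟩ := hsurj x
    obtain ⟨e', Q, rfl, rfl⟩ := exists_path_lift hp q
    obtain ⟨e'', Q', he, rfl⟩ := exists_path_lift hp q'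
    obtain ⟨H⟩ : Q.toContinuousMap.HomotopicRel Q'.toContinuousMap {0, 1} :=
      (hp.homotopicRel_iff_comp ⟨0, by simp⟩).mpr h
    obtain rfl : e' = e'' := by
      simpa using (H.eq_fst 0 (x := 1) (by simp)).symm.trans (H.eq_snd 0 (by simp))
    exact (hvalue Q).trans (hvalue Q').symm

end CoveringCocycle

section Circle

variable {G : Type*} [Group G]

/-- The covering of the circle by the real line. -/
def circleCovering : C(ℝ, UnitAddCircle) := ⟨(↑), AddCircle.continuous_mk' 1⟩

theorem floor_sub_floor_eq_of_coe_eq {Γ Γ' : C(I, ℝ)}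
    (h : circleCovering.comp Γ = circleCovering.comp Γ') :
    ⌊Γ 1⌋ - ⌊Γ 0⌋ = ⌊Γ' 1⌋ - ⌊Γ' 0⌋ := by
  obtain ⟨n, hn⟩ : ∃ n : ℤ, n • (1 : ℝ) = Γ 0 - Γ' 0 := (AddCircle.coe_eq_zero_iff 1).mp <| by
    rw [AddCircle.coe_sub, sub_eq_zero]
    exact congr($h 0)
  have hΓ (t : I) : Γ t = Γ' t + n := by
    refine congrFun ((AddCircle.isCoveringMap_coe (1 : ℝ)).eq_of_comp_eq Γ.continuous
      (g₂ := fun t => Γ' t + n) (by fun_prop) (funext fun t => ?_) 0 ?_) t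
    · refine (congr($h t) : circleCovering (Γ t) = circleCovering (Γ' t)).trans ?_
      change (Γ' t : UnitAddCircle) = ((Γ' t + n : ℝ) : UnitAddCircle)
      simp
    · simp only [zsmul_eq_mul, mul_one] at hn
      linarith
  rw [hΓ, hΓ, Int.floor_add_intCast, Int.floor_add_intCast, add_sub_add_right_eq_sub]

/-- The circle without its base point. -/
abbrev PuncturedCircle : Type := ({0}ᶜ : Set UnitAddCircle)

/-- The identification of the punctured circle with the open unit interval. -/
noncomputable def puncturedCircleHomeomorph : Set.Ioo (0 : ℝ) (0 + 1) ≃ₜ PuncturedCircle :=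
  (AddCircle.openPartialHomeomorphCoe (1 : ℝ) 0).toHomeomorphSourceTarget

instance : ContractibleSpace PuncturedCircle :=
  puncturedCircleHomeomorph.contractibleSpace_iff.mp <|
    (convex_Ioo 0 _).contractibleSpace (Set.nonempty_Ioo.mpr (by norm_num))

theorem exists_crossing (g : G) : ∃ F : PathCocycle UnitAddCircle G,
    (∀ Γ : C(I, ℝ), F (circleCovering.comp Γ) = g ^ (⌊Γ 1⌋ - ⌊Γ 0⌋)) ∧
    ∀ r : C(I, UnitAddCircle), (∀ t, r t ≠ 0) → F r = 1 := by
  obtain ⟨F, hF⟩ := PathCocycle.exists_of_isCoveringMap (p := circleCovering)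
    (AddCircle.isCoveringMap_coe (1 : ℝ)) QuotientAddGroup.mk_surjective (fun t => g ^ ⌊t⌋)
    fun Γ Γ' h => by rw [← zpow_sub, ← zpow_sub, floor_sub_floor_eq_of_coe_eq h]
  refine ⟨F, fun Γ => by rw [hF, ← zpow_sub], fun r hr => ?_⟩
  let q (t : I) : Set.Ioo (0 : ℝ) (0 + 1) := puncturedCircleHomeomorph.symm ⟨r t, hr t⟩
  let Γ : C(I, ℝ) := ⟨fun t => q t, by fun_prop⟩
  have hΓ : circleCovering.comp Γ = r := ContinuousMap.ext fun t =>
    congrArg Subtype.val (puncturedCircleHomeomorph.apply_symm_apply ⟨r t, hr t⟩)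
  have hfloor (t : I) : ⌊Γ t⌋ = 0 :=
    Int.floor_eq_zero_iff.mpr ⟨(q t).2.1.le, (q t).2.2.trans_eq (zero_add 1)⟩
  rw [← hΓ, hF, hfloor, hfloor, mul_inv_cancel]

theorem zpowers_circle_eq_top {x : UnitAddCircle} (p : Path x x) {s : ℝ}
    (hs : ∀ t : I, p t = ((s + t : ℝ) : UnitAddCircle)) :
    Subgroup.zpowers (.fromPath (.mk p) : FundamentalGroup UnitAddCircle x) = ⊤ :=
  zpowers_eq_top_of_lift (AddCircle.isAddQuotientCoveringMap_coe 1) (zmultiples_gen_eq_top 1)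
    (e := s) ⟨⟨fun t => s + t, by fun_prop⟩, by simp, by simp [AddSubgroup.vadd_def, add_comm]⟩ p
    fun t => (hs t).symm

end Circle

section Cylinder

variable {A B : Type*} [TopologicalSpace A] [TopologicalSpace B]

theorem mapOfEq_fromPath_mk {f : C(A, B)} {a : A} {b : B} (hab : f a = b) {p : Path a a}
    {q : Path b b} (hpq : ∀ t, f (p t) = q t) :
    FundamentalGroup.mapOfEq f hab (.fromPath (.mk p)) = .fromPath (.mk q) := by
  subst hab
  obtain rfl : p.map f.continuous = q := Path.ext (funext hpq)
  rw [FundamentalGroup.mapOfEq_apply, Path.Homotopic.Quotient.cast_rfl_rfl]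
  rfl

theorem mapOfEq_mapOfEq {C : Type*} [TopologicalSpace C] {f : C(A, B)} {g : C(B, C)} {k : C(A, C)}
    (h : ∀ x, g (f x) = k x) {a : A} {b : B} {c : C} (hab : f a = b) (hbc : g b = c) (hac : k a = c)
    (γ : FundamentalGroup A a) :
    FundamentalGroup.mapOfEq g hbc (FundamentalGroup.mapOfEq f hab γ) =
      FundamentalGroup.mapOfEq k hac γ := by
  obtain ⟨p, rfl⟩ := Path.Homotopic.Quotient.mk_surjective γ
  subst hab hac
  obtain rfl : g.comp f = k := ContinuousMap.ext h
  simp only [FundamentalGroup.mapOfEq_apply, Path.Homotopic.Quotient.cast_rfl_rfl]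
  rfl

theorem range_mapOfEq_eq_zpowers {f : C(A, B)} {a : A} {b : B} (hab : f a = b) {p : Path a a}
    (hp : Subgroup.zpowers (.fromPath (.mk p) : FundamentalGroup A a) = ⊤) {q : Path b b}
    (hpq : ∀ t, f (p t) = q t) :
    (FundamentalGroup.mapOfEq f hab).range = Subgroup.zpowers (.fromPath (.mk q)) := by
  rw [MonoidHom.range_eq_map, ← hp, MonoidHom.map_zpowers, mapOfEq_fromPath_mk hab hpq]

theorem zpowers_eq_top_of_injective {G H : Type*} [Group G] [Group H] {h : G →* H}
    (hh : Function.Injective h) {g : G} (hg : Subgroup.zpowers (h g) = ⊤) :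
    Subgroup.zpowers g = ⊤ :=
  Subgroup.map_injective hh <| by
    rw [MonoidHom.map_zpowers, hg, eq_comm, eq_top_iff, ← hg, Subgroup.zpowers_le]
    exact ⟨g, trivial, rfl⟩

theorem injective_map_fst [SimplyConnectedSpace B] (z : A × B) :
    Function.Injective (FundamentalGroup.map (.fst : C(A × B, A)) z) := fun γ γ' h => by
  have h : Path.Homotopic.projLeft γ = Path.Homotopic.projLeft γ' := h
  rw [← Path.Homotopic.prod_projLeft_projRight γ, ← Path.Homotopic.prod_projLeft_projRight γ', h,
    Subsingleton.elim (Path.Homotopic.projRight γ)]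

theorem injective_map_snd [SimplyConnectedSpace A] (z : A × B) :
    Function.Injective (FundamentalGroup.map (.snd : C(A × B, B)) z) := fun γ γ' h => by
  have h : Path.Homotopic.projRight γ = Path.Homotopic.projRight γ' := h
  rw [← Path.Homotopic.prod_projLeft_projRight γ, ← Path.Homotopic.prod_projLeft_projRight γ', h,
    Subsingleton.elim (Path.Homotopic.projLeft γ)]

theorem zpowers_prod_refl [SimplyConnectedSpace B] {a : A} {p : Path a a}
    (hp : Subgroup.zpowers (.fromPath (.mk p) : FundamentalGroup A a) = ⊤) (b : B) :
    Subgroup.zpowers (.fromPath (.mk (p.prod (.refl b))) : FundamentalGroup (A × B) (a, b)) = ⊤ :=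
  zpowers_eq_top_of_injective (injective_map_fst (a, b)) hp

theorem zpowers_refl_prod [SimplyConnectedSpace A] (a : A) {b : B} {p : Path b b}
    (hp : Subgroup.zpowers (.fromPath (.mk p) : FundamentalGroup B b) = ⊤) :
    Subgroup.zpowers (.fromPath (.mk ((Path.refl a).prod p)) : FundamentalGroup (A × B) (a, b)) =
      ⊤ :=
  zpowers_eq_top_of_injective (injective_map_snd (a, b)) hp

end Cylinder

section PuncturedTorus

variable {G : Type*} [Group G]

/-- The torus without its base point. -/
abbrev PuncturedTorus : Type := ({0}ᶜ : Set Torus)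

/-- The part of the punctured torus away from the first coordinate circle. -/
def torusLeft : C(UnitAddCircle × PuncturedCircle, PuncturedTorus) where
  toFun z := ⟨(z.1, z.2), fun h => z.2.2 (congrArg Prod.snd h)⟩

/-- The part of the punctured torus away from the second coordinate circle. -/
def torusRight : C(PuncturedCircle × UnitAddCircle, PuncturedTorus) where
  toFun z := ⟨(z.1, z.2), fun h => z.1.2 (congrArg Prod.fst h)⟩

/-- The inclusion of the punctured circle in the circle. -/
def puncturedCircleInclusion : C(PuncturedCircle, UnitAddCircle) := ⟨Subtype.val, by fun_prop⟩

theorem isOpenSquare_torus : IsOpenSquare torusLeft torusRight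
    (puncturedCircleInclusion.prodMap (.id _)) (.prodMap (.id _) puncturedCircleInclusion) where
  isOpenEmbedding_left := .of_comp _ isOpen_compl_singleton.isOpenEmbedding_subtypeVal
    (IsOpenEmbedding.id.prodMap isOpen_compl_singleton.isOpenEmbedding_subtypeVal)
  isOpenEmbedding_right := .of_comp _ isOpen_compl_singleton.isOpenEmbedding_subtypeVal
    (isOpen_compl_singleton.isOpenEmbedding_subtypeVal.prodMap .id)
  isEmbedding := IsEmbedding.subtypeVal.prodMap .id
  comm _ := rfl
  cover z := by
    by_cases h : z.1.2 = 0
    · exact .inr ⟨(⟨z.1.1, fun h' => z.2 (Prod.ext h' h)⟩, z.1.2), rfl⟩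
    · exact .inl ⟨(z.1.1, ⟨z.1.2, h⟩), rfl⟩
  overlap {y₁ y₂} h := ⟨(y₂.1, y₁.2), Prod.ext congr(($h).1.1).symm rfl⟩

instance : PathConnectedSpace PuncturedTorus :=
  haveI : Nonempty (PuncturedCircle × PuncturedCircle) := inferInstance
  isOpenSquare_torus.pathConnectedSpace

/-- The cocycle multiplies by `g false` or by `g true` whenever the first or the second coordinate
crosses `0` in the positive direction. The number of crossings along a path is read off a lift `Γ`
of the moving coordinate to the real line. -/
structure IsTorusCocycle (F : PathCocycle PuncturedTorus G) (g : Bool → G) : Prop where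
  fst (r : C(I, PuncturedTorus)) (Γ : C(I, ℝ)) (hr : ∀ t, (r t).1.2 ≠ 0)
    (hΓ : ∀ t, (r t).1.1 = Γ t) : F r = g false ^ (⌊Γ 1⌋ - ⌊Γ 0⌋)
  snd (r : C(I, PuncturedTorus)) (Γ : C(I, ℝ)) (hr : ∀ t, (r t).1.1 ≠ 0)
    (hΓ : ∀ t, (r t).1.2 = Γ t) : F r = g true ^ (⌊Γ 1⌋ - ⌊Γ 0⌋)

theorem exists_isTorusCocycle (g : Bool → G) : ∃ F, IsTorusCocycle F g := by
  obtain ⟨A, hA, hA₀⟩ := exists_crossing (g false)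
  obtain ⟨B, hB, hB₀⟩ := exists_crossing (g true)
  obtain ⟨F, hFA, hFB⟩ := isOpenSquare_torus.exists_glue (F₁ := A.comap .fst) (F₂ := B.comap .snd)
    (PathCocycle.ext (funext fun r =>
      (hA₀ (.comp ⟨fun z => z.1.1, by fun_prop⟩ r) fun t => (r t).1.2).trans
        (hB₀ (.comp ⟨fun z => z.2.1, by fun_prop⟩ r) fun t => (r t).2.2).symm))
  refine ⟨F, fun r Γ hr hΓ => ?_, fun r Γ hr hΓ => ?_⟩
  · let q : C(I, UnitAddCircle × PuncturedCircle) := ⟨fun t => ((r t).1.1, ⟨_, hr t⟩), by fun_prop⟩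
    refine (congr(($hFA) q) : F (torusLeft.comp q) = A (.comp .fst q)).trans ?_
    rw [← hA]
    exact congrArg A (ContinuousMap.ext hΓ)
  · let q : C(I, PuncturedCircle × UnitAddCircle) := ⟨fun t => (⟨_, hr t⟩, (r t).1.2), by fun_prop⟩
    refine (congr(($hFB) q) : F (torusRight.comp q) = B (.comp .snd q)).trans ?_
    rw [← hB]
    exact congrArg B (ContinuousMap.ext hΓ)

/-- The point of the circle opposite to the base point. -/
noncomputable def halfPoint : PuncturedCircle := puncturedCircleHomeomorph ⟨1 / 2, by norm_num⟩

/-- The loop that turns once around the circle, starting opposite to the base point. -/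
noncomputable def halfPointLoop : Path (halfPoint : UnitAddCircle) halfPoint where
  toFun t := ((1 / 2 + t : ℝ) : UnitAddCircle)
  continuous_toFun := (AddCircle.continuous_mk' 1).comp (by fun_prop)
  source' := congrArg _ (add_zero _)
  target' := AddCircle.coe_add_period _ _

/-- The loops that turn once around the punctured torus in the first or the second direction. -/
noncomputable def torusLoop :
    Bool → Path (torusLeft (halfPoint, halfPoint)) (torusLeft (halfPoint, halfPoint))
  | false => (halfPointLoop.prod (.refl halfPoint)).map torusLeft.continuous
  | true => ((Path.refl halfPoint).prod halfPointLoop).map torusRight.continuous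

theorem zpowers_torusLoop_sup :
    Subgroup.zpowers (.fromPath (.mk (torusLoop false)) : FundamentalGroup PuncturedTorus _) ⊔
      Subgroup.zpowers (.fromPath (.mk (torusLoop true))) = ⊤ := by
  have hp := zpowers_circle_eq_top halfPointLoop (s := 1 / 2) fun _ => rfl
  refine .trans (congr_arg₂ _ ?_ ?_) (isOpenSquare_torus.range_sup_range (halfPoint, halfPoint))
  · exact (range_mapOfEq_eq_zpowers rfl (zpowers_prod_refl hp halfPoint) fun _ => rfl).symm
  · exact (range_mapOfEq_eq_zpowers _ (zpowers_refl_prod halfPoint hp) fun _ => rfl).symm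

theorem IsTorusCocycle.hom_torusLoop {F : PathCocycle PuncturedTorus G} {g : Bool → G}
    (hF : IsTorusCocycle F g) (i : Bool) : F.hom _ (.fromPath (.mk (torusLoop i))) = g i := by
  let Γ : C(I, ℝ) := ⟨fun t => 1 / 2 + t, by fun_prop⟩
  have hΓ : ⌊Γ 1⌋ - ⌊Γ 0⌋ = 1 := by
    simp only [Γ, ContinuousMap.coe_mk, Set.Icc.coe_one, Set.Icc.coe_zero]
    norm_num
  rw [← zpow_one (g i), ← hΓ]
  cases i
  · exact hF.fst _ Γ (fun _ => halfPoint.2) fun _ => rfl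
  · exact hF.snd _ Γ (fun _ => halfPoint.2) fun _ => rfl

end PuncturedTorus

section BasePoint

namespace PathCocycle

variable {X G : Type*} [TopologicalSpace X] [Group G]

theorem map_symm (F : PathCocycle X G) {x y : X} (p : Path x y) :
    F p.symm.toContinuousMap = (F p.toContinuousMap)⁻¹ := by
  refine eq_inv_of_mul_eq_one_left ?_
  rw [← F.map_trans, ← F.map_homotopic ⟨.reflTransSymm p⟩]
  exact F.map_const x

theorem hom_fundamentalGroupMulEquivOfPath (F : PathCocycle X G) {x y : X} (p : Path x y)
    (γ : FundamentalGroup X x) :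
    F.hom y (FundamentalGroup.fundamentalGroupMulEquivOfPath p γ) =
      F p.toContinuousMap * F.hom x γ * (F p.toContinuousMap)⁻¹ := by
  obtain ⟨q, rfl⟩ := Path.Homotopic.Quotient.mk_surjective γ
  rw [← F.map_symm]
  change F (p.symm.trans (q.trans p)).toContinuousMap = F _ * F q.toContinuousMap * F _
  rw [F.map_trans, F.map_trans]

theorem hom_eq_conj_comp (F : PathCocycle X G) {x y : X} (p : Path x y) :
    F.hom y = (MulAut.conj (F p.toContinuousMap)).toMonoidHom.comp ((F.hom x).comp
      (FundamentalGroup.fundamentalGroupMulEquivOfPath p).symm.toMonoidHom) :=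
  MonoidHom.ext fun γ =>
    (congrArg _ (MulEquiv.apply_symm_apply _ γ).symm).trans
      (F.hom_fundamentalGroupMulEquivOfPath p _)

theorem bijective_hom_of_path (F : PathCocycle X G) {x y : X} (p : Path x y)
    (hx : Function.Bijective (F.hom x)) : Function.Bijective (F.hom y) := by
  rw [F.hom_eq_conj_comp p]
  exact (MulAut.conj (F p.toContinuousMap)).bijective.comp (hx.comp (MulEquiv.bijective _))

theorem range_hom_eq_map_conj (F : PathCocycle X G) {x y : X} (p : Path x y) :
    (F.hom y).range = (F.hom x).range.map (MulAut.conj (F p.toContinuousMap)).toMonoidHom := by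
  rw [F.hom_eq_conj_comp p, MonoidHom.range_comp, MonoidHom.range_comp,
    MonoidHom.range_eq_top.mpr (MulEquiv.surjective _), ← MonoidHom.range_eq_map]

end PathCocycle

theorem bijective_of_hom_apply_eq_of {P ι : Type*} [Group P] {l : ι → P}
    (hl : Subgroup.closure (Set.range l) = ⊤) {h : P →* FreeGroup ι}
    (hh : ∀ i, h (l i) = FreeGroup.of i) : Function.Bijective h := by
  have hleft : (FreeGroup.lift l).comp h = .id P :=
    MonoidHom.eq_of_eqOn_dense hl (by rintro _ ⟨i, rfl⟩; simp [hh])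
  have hright : h.comp (FreeGroup.lift l) = .id _ := FreeGroup.ext_hom _ _ fun i => by simp [hh]
  exact ⟨Function.LeftInverse.injective (DFunLike.congr_fun hleft),
    Function.RightInverse.surjective (DFunLike.congr_fun hright)⟩

end BasePoint

section TorusChart

/-- The chart of the circle around its base point. -/
noncomputable def circleChart (t : ℝ) : UnitAddCircle := ((t.sigmoid - 1 / 2 : ℝ) : UnitAddCircle)

theorem circleChart_zero : circleChart 0 = 0 := by
  simp [circleChart, Real.sigmoid_zero]

theorem isOpenEmbedding_circleChart : IsOpenEmbedding circleChart := by
  have hsigmoid : IsOpenEmbedding Real.sigmoid := by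
    refine ⟨Real.sigmoid_strictMono.isEmbedding_of_ordConnected ?_, ?_⟩ <;> rw [Real.range_sigmoid]
    exacts [Set.ordConnected_Ioo, isOpen_Ioo]
  have hreal := (Homeomorph.subRight (1 / 2 : ℝ)).isOpenEmbedding.comp hsigmoid
  refine .of_continuous_injective_isOpenMap
    ((AddCircle.continuous_mk' (1 : ℝ)).comp hreal.continuous) (fun s t h => ?_)
    ((AddCircle.isLocalHomeomorph_coe (1 : ℝ)).isOpenMap.comp hreal.isOpenMap)
  have hmem (t : ℝ) : t.sigmoid - 1 / 2 ∈ Set.Ioo (-1 / 2 : ℝ) (-1 / 2 + 1) :=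
    ⟨by linarith [Real.sigmoid_pos t], by linarith [Real.sigmoid_lt_one t]⟩
  exact hreal.injective ((AddCircle.openPartialHomeomorphCoe 1 (-1 / 2)).injOn (hmem s) (hmem t) h)

theorem circleChart_ne_zero {t : ℝ} (ht : t ≠ 0) : circleChart t ≠ 0 :=
  circleChart_zero ▸ isOpenEmbedding_circleChart.injective.ne ht

theorem floor_sigmoid_sub_half (t : ℝ) : ⌊t.sigmoid - 1 / 2⌋ = if 0 ≤ t then 0 else -1 := by
  have hzero := Real.sigmoid_zero
  split_ifs with ht <;> refine Int.floor_eq_iff.mpr ?_ <;> push_cast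
  · have hmono := Real.sigmoid_strictMono.monotone ht
    constructor <;> linarith [Real.sigmoid_lt_one t]
  · have hmono := Real.sigmoid_strictMono (not_le.mp ht)
    constructor <;> linarith [Real.sigmoid_pos t]

/-- The chart of the torus around its base point. -/
noncomputable def torusChart : RegularBall 2 Torus where
  toFun z := (circleChart (z 0), circleChart (z 1))
  isOpenEmbedding := (isOpenEmbedding_circleChart.prodMap isOpenEmbedding_circleChart).comp
    ((EuclideanSpace.equiv (Fin 2) ℝ).toHomeomorph.trans .finTwoArrow).isOpenEmbedding

theorem torusChart_zero : torusChart.toFun 0 = 0 := Prod.ext circleChart_zero circleChart_zero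

/-- The patch of a ball around `p`, without its center. -/
def RegularBall.punctured {n : ℕ} {X : Type*} [TopologicalSpace X] (e : RegularBall n X) {p : X}
    (hp : e.toFun 0 = p) : C(PuncturedSpace n, ({p}ᶜ : Set X)) where
  toFun z := ⟨e.toFun z, fun h => z.2 (e.isOpenEmbedding.injective (h.trans hp.symm))⟩
  continuous_toFun := (e.isOpenEmbedding.continuous.comp continuous_subtype_val).subtype_mk _

variable {G : Type*} [Group G] {F : PathCocycle PuncturedTorus G} {g : Bool → G}

theorem IsTorusCocycle.fst_torusChart (hF : IsTorusCocycle F g) (r : C(I, PuncturedPlane))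
    (hr : ∀ t, (r t : Plane) 1 ≠ 0) : F ((torusChart.punctured torusChart_zero).comp r) =
      g false ^ ((if 0 ≤ (r 1 : Plane) 0 then 0 else -1) -
        (if 0 ≤ (r 0 : Plane) 0 then 0 else -1) : ℤ) := by
  rw [← floor_sigmoid_sub_half, ← floor_sigmoid_sub_half]
  exact hF.fst _ ⟨fun t => ((r t : Plane) 0).sigmoid - 1 / 2, by fun_prop⟩
    (fun t => circleChart_ne_zero (hr t)) fun _ => rfl

theorem IsTorusCocycle.snd_torusChart (hF : IsTorusCocycle F g) (r : C(I, PuncturedPlane))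
    (hr : ∀ t, (r t : Plane) 0 ≠ 0) : F ((torusChart.punctured torusChart_zero).comp r) =
      g true ^ ((if 0 ≤ (r 1 : Plane) 1 then 0 else -1) -
        (if 0 ≤ (r 0 : Plane) 1 then 0 else -1) : ℤ) := by
  rw [← floor_sigmoid_sub_half, ← floor_sigmoid_sub_half]
  exact hF.snd _ ⟨fun t => ((r t : Plane) 1).sigmoid - 1 / 2, by fun_prop⟩
    (fun t => circleChart_ne_zero (hr t)) fun _ => rfl

end TorusChart

section BoundaryLoop

/-- The point `(1, 1)` of the punctured plane. -/
noncomputable def diagonalPoint : PuncturedPlane :=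
  complexPunctured ⟨1 + Complex.I, fun h => by simpa using congrArg Complex.re h⟩

theorem circleCurve_diagonalPoint_zero (θ : ℝ) :
    (circleCurve diagonalPoint θ : Plane) 0 = Real.cos θ - Real.sin θ := by
  have h : (circleCurve diagonalPoint θ : Plane) 0 =
      ((1 + Complex.I) * Complex.exp (θ * Complex.I)).re := by
    simp [circleCurve, diagonalPoint, complexPunctured]
  rw [h, Complex.exp_mul_I]
  simp [← Complex.ofReal_cos, ← Complex.ofReal_sin]

theorem circleCurve_diagonalPoint_one (θ : ℝ) :
    (circleCurve diagonalPoint θ : Plane) 1 = Real.cos θ + Real.sin θ := by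
  have h : (circleCurve diagonalPoint θ : Plane) 1 =
      ((1 + Complex.I) * Complex.exp (θ * Complex.I)).im := by
    simp [circleCurve, diagonalPoint, complexPunctured]
  rw [h, Complex.exp_mul_I]
  simp [← Complex.ofReal_cos, ← Complex.ofReal_sin]
  ring

theorem cos_add_sin_pos (t : I) :
    0 < Real.cos (t * (Real.pi / 2)) + Real.sin (t * (Real.pi / 2)) := by
  have hpi := Real.pi_pos
  have hmem : (t : ℝ) * (Real.pi / 2) ∈ Set.Icc 0 (Real.pi / 2) :=
    ⟨by have := t.2.1; positivity, mul_le_of_le_one_left (by positivity) t.2.2⟩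
  have hcos := Real.cos_nonneg_of_mem_Icc ⟨by linarith [hmem.1], hmem.2⟩
  have hsin := Real.sin_nonneg_of_mem_Icc ⟨hmem.1, by linarith [hmem.2]⟩
  nlinarith [Real.sin_sq_add_cos_sq (t * (Real.pi / 2))]

/-- A quarter of the circle through `diagonalPoint`, starting at the angle `φ`. -/
noncomputable def quarterArc (φ : ℝ) : C(I, PuncturedPlane) where
  toFun t := circleCurve diagonalPoint (t * (Real.pi / 2) + φ)
  continuous_toFun := by fun_prop

theorem quarterArc_zero (φ : ℝ) (t : I) : (quarterArc φ t : Plane) 0 =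
    Real.cos (t * (Real.pi / 2) + φ) - Real.sin (t * (Real.pi / 2) + φ) :=
  circleCurve_diagonalPoint_zero _

theorem quarterArc_one (φ : ℝ) (t : I) : (quarterArc φ t : Plane) 1 =
    Real.cos (t * (Real.pi / 2) + φ) + Real.sin (t * (Real.pi / 2) + φ) :=
  circleCurve_diagonalPoint_one _

variable {G : Type*} [Group G] {F : PathCocycle PuncturedTorus G} {g : Bool → G}

theorem IsTorusCocycle.fst_quarterArc (hF : IsTorusCocycle F g) :
    F ((torusChart.punctured torusChart_zero).comp (quarterArc 0)) = (g false)⁻¹ ∧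
      F ((torusChart.punctured torusChart_zero).comp (quarterArc Real.pi)) = g false := by
  constructor <;> rw [hF.fst_torusChart]
  · simp [quarterArc_zero]
  · simpa [quarterArc_one] using fun t ht => (cos_add_sin_pos ⟨t, ht⟩).ne'
  · simp [quarterArc_zero, (zero_lt_one' ℝ).not_ge]
  · intro t
    have := cos_add_sin_pos t
    rw [quarterArc_one, Real.cos_add_pi, Real.sin_add_pi]
    linarith

theorem IsTorusCocycle.snd_quarterArc (hF : IsTorusCocycle F g) :
    F ((torusChart.punctured torusChart_zero).comp (quarterArc (Real.pi / 2))) = (g true)⁻¹ ∧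
      F ((torusChart.punctured torusChart_zero).comp (quarterArc (Real.pi / 2 + Real.pi))) =
        g true := by
  constructor <;> rw [hF.snd_torusChart]
  · simp [quarterArc_one]
  · intro t
    have := cos_add_sin_pos t
    rw [quarterArc_zero, Real.cos_add_pi_div_two, Real.sin_add_pi_div_two]
    linarith
  · simp [quarterArc_one, ← add_assoc, Real.cos_add_pi, Real.sin_add_pi, (zero_lt_one' ℝ).not_ge]
  · intro t
    have := cos_add_sin_pos t
    rw [quarterArc_zero, ← add_assoc, Real.cos_add_pi, Real.sin_add_pi, Real.cos_add_pi_div_two,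
      Real.sin_add_pi_div_two]
    linarith

/- Along each quarter of the circle one coordinate keeps its sign while the other crosses `0`. -/
theorem IsTorusCocycle.map_circleLoop (hF : IsTorusCocycle F g) :
    F ((torusChart.punctured torusChart_zero).comp (circleLoop diagonalPoint).toContinuousMap) =
      ⁅g true, g false⁆ := by
  let d := torusChart.punctured torusChart_zero
  obtain ⟨k, hk⟩ := (F.comap (d.comp (circleCurve diagonalPoint))).exists_gauge
  have hstep (φ : ℝ) : F (d.comp (quarterArc φ)) * k φ = k (Real.pi / 2 + φ) := by
    have h : F (d.comp (quarterArc φ)) * k (0 * (Real.pi / 2) + φ) = k (1 * (Real.pi / 2) + φ) :=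
      hk ⟨fun t => t * (Real.pi / 2) + φ, by fun_prop⟩
    rwa [zero_mul, zero_add, one_mul] at h
  have hloop : F (d.comp (circleLoop diagonalPoint).toContinuousMap) * k (2 * Real.pi * 0) =
      k (2 * Real.pi * 1) := hk ⟨fun t => 2 * Real.pi * t, by fun_prop⟩
  have h₁ : (g false)⁻¹ * k 0 = k (Real.pi / 2) := by
    rw [← hF.fst_quarterArc.1, hstep, add_zero]
  have h₂ : (g true)⁻¹ * k (Real.pi / 2) = k Real.pi := by
    rw [← hF.snd_quarterArc.1, hstep, add_halves]
  have h₃ : g false * k Real.pi = k (Real.pi / 2 + Real.pi) := by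
    rw [← hF.fst_quarterArc.2, hstep]
  have h₄ : g true * k (Real.pi / 2 + Real.pi) = k (2 * Real.pi) := by
    rw [← hF.snd_quarterArc.2, hstep, ← add_assoc, add_halves, two_mul]
  rw [mul_zero, mul_one, ← h₄, ← h₃, ← h₂, ← h₁] at hloop
  refine mul_right_cancel (hloop.trans ?_)
  simp only [commutatorElement_def, mul_assoc]

end BoundaryLoop

section Torus

theorem closure_torusLoop : Subgroup.closure (Set.range fun i =>
    (.fromPath (.mk (torusLoop i)) : FundamentalGroup PuncturedTorus _)) = ⊤ := by
  refine top_unique (zpowers_torusLoop_sup.ge.trans ?_)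
  rw [sup_le_iff, Subgroup.zpowers_le, Subgroup.zpowers_le]
  exact ⟨Subgroup.subset_closure ⟨false, rfl⟩, Subgroup.subset_closure ⟨true, rfl⟩⟩

theorem exists_cocycle_puncturedTorus : ∃ F : PathCocycle PuncturedTorus (FreeGroup Bool),
    (∀ x, Function.Bijective (F.hom x)) ∧
    F ((torusChart.punctured torusChart_zero).comp (circleLoop diagonalPoint).toContinuousMap) =
      ⁅FreeGroup.of true, FreeGroup.of false⁆ := by
  obtain ⟨F, hF⟩ := exists_isTorusCocycle FreeGroup.of
  refine ⟨F, fun x => ?_, hF.map_circleLoop⟩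
  exact F.bijective_hom_of_path (PathConnectedSpace.somePath _ x)
    (bijective_of_hom_apply_eq_of closure_torusLoop hF.hom_torusLoop)

end Torus

section HomotopyEquiv

variable {X Y : Type*} [TopologicalSpace X] [TopologicalSpace Y]

/-- The isomorphism of fundamental groups induced by a homotopy equivalence. -/
noncomputable def fundamentalGroupCongr (e : ContinuousMap.HomotopyEquiv X Y) (x : X) :
    FundamentalGroup X x ≃* FundamentalGroup Y (e x) :=
  haveI : (FundamentalGroupoid.map e.toFun).IsEquivalence :=
    (FundamentalGroupoidFunctor.equivOfHomotopyEquiv e).isEquivalence_functor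
  (CategoryTheory.Functor.FullyFaithful.ofFullyFaithful
    (FundamentalGroupoid.map e.toFun)).mulEquivEnd (.mk x)

theorem fundamentalGroupCongr_apply (e : ContinuousMap.HomotopyEquiv X Y) {x : X}
    (γ : FundamentalGroup X x) :
    fundamentalGroupCongr e x γ = FundamentalGroup.mapOfEq e.toFun rfl γ := by
  rw [FundamentalGroup.mapOfEq_apply, Path.Homotopic.Quotient.cast_rfl_rfl]
  rfl

theorem zpowers_mapOfEq_eq_top (e : ContinuousMap.HomotopyEquiv X Y) {x : X}
    {γ : FundamentalGroup X x} (hγ : Subgroup.zpowers γ = ⊤) :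
    Subgroup.zpowers (FundamentalGroup.mapOfEq e.toFun rfl γ) = ⊤ := by
  rw [← fundamentalGroupCongr_apply, ← MulEquiv.coe_toMonoidHom, ← MonoidHom.map_zpowers, hγ]
  exact Subgroup.map_top_of_surjective _ (fundamentalGroupCongr e x).surjective

end HomotopyEquiv

section CyclicSubgroups

open Subgroup

theorem eq_or_eq_inv_of_zpowers_eq {G : Type*} [Group G] [IsMulTorsionFree G] {x y : G}
    (h : zpowers x = zpowers y) : x = y ∨ x = y⁻¹ := by
  obtain rfl | hx := eq_or_ne x 1
  · rw [zpowers_one_eq_bot, eq_comm, zpowers_eq_bot] at h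
    exact .inl h.symm
  · rw [← inv_eq_iff_eq_inv]
    exact (zpowers_eq_zpowers_iff fun h => hx h.eq_one').mp h

theorem exists_mulEquiv_apply_eq_commutator {x u : FreeGroup Bool}
    (h : zpowers x = (zpowers ⁅FreeGroup.of true, FreeGroup.of false⁆).map
      (MulAut.conj u).toMonoidHom) :
    ∃ θ : FreeGroup Bool ≃* FreeGroup Bool, θ x = ⁅FreeGroup.of true, FreeGroup.of false⁆ := by
  rw [MonoidHom.map_zpowers] at h
  obtain rfl | rfl := eq_or_eq_inv_of_zpowers_eq h
  · exact ⟨(MulAut.conj u).symm, MulEquiv.symm_apply_apply _ _⟩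
  · refine ⟨(MulAut.conj u).symm.trans (FreeGroup.freeGroupCongr Equiv.boolNot), ?_⟩
    rw [map_inv, MulEquiv.trans_apply]
    refine (congrArg (fun y => (FreeGroup.freeGroupCongr Equiv.boolNot y)⁻¹)
      (MulEquiv.symm_apply_apply (MulAut.conj u) _)).trans ?_
    simp [map_commutatorElement]

end CyclicSubgroups

section ComparisonOfPatches

namespace RegularBall

variable {n : ℕ} {X G : Type*} [TopologicalSpace X] [Group G] {p : X}

theorem isOpenEmbedding_punctured (e : RegularBall n X) (hp : e.toFun 0 = p) :
    IsOpenEmbedding (e.punctured hp) := by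
  have hcomp : IsOpenEmbedding (Subtype.val ∘ e.punctured hp) :=
    e.isOpenEmbedding.comp isOpen_compl_singleton.isOpenEmbedding_subtypeVal
  refine ⟨.of_comp (e.punctured hp).continuous continuous_subtype_val hcomp.isEmbedding, ?_⟩
  rw [← Subtype.val_injective.preimage_image (Set.range _), ← Set.range_comp]
  exact hcomp.isOpen_range.preimage continuous_subtype_val

theorem exists_punctured_eq {e d : RegularBall n X} (he : e.toFun 0 = p) (hd : d.toFun 0 = p)
    {r : C(I, PuncturedSpace n)}
    (hr : ∀ t, e.toFun (r t) ∈ Set.range d.toFun) :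
    ∃ q, (d.punctured hd).comp q = (e.punctured he).comp r := by
  refine exists_comp_eq (d.isOpenEmbedding_punctured hd).isEmbedding fun t => ?_
  obtain ⟨z, hz⟩ := hr t
  refine ⟨⟨z, ?_⟩, Subtype.ext hz⟩
  rintro rfl
  exact (e.punctured he (r t)).2 (hz.symm.trans hd)

variable {e d : RegularBall 2 X} (he : e.toFun 0 = p) (hd : d.toFun 0 = p)
  (F : PathCocycle ({p}ᶜ : Set X) G)
include F

theorem range_hom_comap_punctured_le {w v : PuncturedPlane}
    (hwv : e.punctured he w = d.punctured hd v)
    (h : ∀ z, ‖z‖ = ‖(w : Plane)‖ → e.toFun z ∈ Set.range d.toFun) :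
    ((F.comap (e.punctured he)).hom w).range ≤ ((F.comap (d.punctured hd)).hom v).range := by
  obtain ⟨q, hq⟩ := exists_punctured_eq he hd (r := (circleLoop w).toContinuousMap)
    fun t => h _ (norm_circleLoop w t)
  have hend (t : I) (ht : circleLoop w t = w) : q t = v :=
    (d.isOpenEmbedding_punctured hd).injective <|
      congr($hq t).trans ((congrArg (e.punctured he) ht).trans hwv)
  rw [MonoidHom.range_eq_map, ← zpowers_circleLoop w, MonoidHom.map_zpowers, Subgroup.zpowers_le]
  exact ⟨.fromPath (.mk ⟨q, hend 0 (circleLoop w).source, hend 1 (circleLoop w).target⟩),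
    congrArg F hq⟩

theorem exists_range_hom_comap_punctured_eq : ∃ w v,
    ((F.comap (e.punctured he)).hom w).range = ((F.comap (d.punctured hd)).hom v).range := by
  obtain ⟨ρ, hρ, h₁⟩ : ∃ ρ > 0, Metric.ball 0 ρ ⊆ d.toFun ⁻¹' Set.range e.toFun :=
    Metric.isOpen_iff.mp (e.isOpenEmbedding.isOpen_range.preimage d.isOpenEmbedding.continuous) 0
      ⟨0, he.trans hd.symm⟩
  obtain ⟨ε, hε, h₂⟩ : ∃ ε > 0, Metric.ball 0 ε ⊆ e.toFun ⁻¹' (d.toFun '' Metric.ball 0 ρ) :=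
    Metric.isOpen_iff.mp ((d.isOpenEmbedding.isOpenMap _ Metric.isOpen_ball).preimage
      e.isOpenEmbedding.continuous) 0 ⟨0, Metric.mem_ball_self hρ, hd.trans he.symm⟩
  obtain ⟨w, hw⟩ := exists_norm_eq Plane (half_pos hε).le
  have hwε : ‖w‖ < ε := hw.trans_lt (half_lt_self hε)
  have hw₀ : w ≠ 0 := norm_pos_iff.mp (hw.trans_gt (half_pos hε))
  obtain ⟨v, hv, hvw⟩ := h₂ (mem_ball_zero_iff.mpr hwε)
  have hv₀ : v ≠ 0 := by
    rintro rfl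
    exact hw₀ (e.isOpenEmbedding.injective (hvw.symm.trans (hd.trans he.symm)))
  have hwv : e.punctured he ⟨w, hw₀⟩ = d.punctured hd ⟨v, hv₀⟩ := Subtype.ext hvw.symm
  refine ⟨⟨w, hw₀⟩, ⟨v, hv₀⟩, le_antisymm
    (range_hom_comap_punctured_le he hd F hwv fun z hz => ?_)
    (range_hom_comap_punctured_le hd he F hwv.symm fun z hz => ?_)⟩
  · exact Set.image_subset_range _ _ (h₂ (mem_ball_zero_iff.mpr (hz.trans_lt hwε)))
  · exact h₁ (mem_ball_zero_iff.mpr (hz.trans_lt (mem_ball_zero_iff.mp hv)))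

/- Near the common center each patch contains a small circle of the other one. -/
theorem exists_range_hom_comap_punctured_eq_map_conj (w v : PuncturedPlane) :
    ∃ u : G, ((F.comap (e.punctured he)).hom w).range =
      ((F.comap (d.punctured hd)).hom v).range.map (MulAut.conj u).toMonoidHom := by
  obtain ⟨w', v', h⟩ := exists_range_hom_comap_punctured_eq he hd F
  rw [PathCocycle.range_hom_eq_map_conj _ (PathConnectedSpace.somePath w' w), h,
    PathCocycle.range_hom_eq_map_conj _ (PathConnectedSpace.somePath v v'), Subgroup.map_map]
  exact ⟨_ * _, congrArg (fun c : MulAut G => Subgroup.map c.toMonoidHom _)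
    (map_mul MulAut.conj _ _).symm⟩

end RegularBall

end ComparisonOfPatches

section PuncturedTorusGroup

theorem exists_mulEquiv_puncturedTorus {e : RegularBall 2 Torus} (he : e.toFun 0 = 0)
    {w : PuncturedPlane} {γ : FundamentalGroup PuncturedPlane w} (hγ : Subgroup.zpowers γ = ⊤) :
    ∃ Θ : FundamentalGroup PuncturedTorus (e.punctured he w) ≃* FreeGroup Bool,
      Θ (FundamentalGroup.mapOfEq (e.punctured he) rfl γ) =
        ⁅FreeGroup.of true, FreeGroup.of false⁆ := by
  obtain ⟨F, hbij, hF⟩ := exists_cocycle_puncturedTorus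
  obtain ⟨u, hu⟩ := RegularBall.exists_range_hom_comap_punctured_eq_map_conj he torusChart_zero F w
    diagonalPoint
  rw [MonoidHom.range_eq_map, ← hγ, MonoidHom.map_zpowers, MonoidHom.range_eq_map,
    ← zpowers_circleLoop diagonalPoint, MonoidHom.map_zpowers] at hu
  obtain ⟨θ, hθ⟩ := exists_mulEquiv_apply_eq_commutator (hu.trans (congrArg
    (fun c => (Subgroup.zpowers c).map (MulAut.conj u).toMonoidHom) hF))
  refine ⟨(MulEquiv.ofBijective (F.hom _) (hbij _)).trans θ, ?_⟩
  rw [← hθ, ← F.hom_mapOfEq _ rfl]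
  rfl

theorem exists_mulEquiv_compl_singleton (e : RegularBall 2 Torus) {p : Torus} (he : e.toFun 0 = p)
    {w : PuncturedPlane} {γ : FundamentalGroup PuncturedPlane w} (hγ : Subgroup.zpowers γ = ⊤) :
    ∃ Θ : FundamentalGroup ({p}ᶜ : Set Torus) (e.punctured he w) ≃* FreeGroup Bool,
      Θ (FundamentalGroup.mapOfEq (e.punctured he) rfl γ) =
        ⁅FreeGroup.of true, FreeGroup.of false⁆ := by
  let τ : Torus ≃ₜ Torus := .subRight p
  let H : ({p}ᶜ : Set Torus) ≃ₜ PuncturedTorus := τ.subtype fun x => sub_ne_zero.symm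
  obtain ⟨Θ, hΘ⟩ := exists_mulEquiv_puncturedTorus
    (e := ⟨τ ∘ e.toFun, τ.isOpenEmbedding.comp e.isOpenEmbedding⟩) (sub_eq_zero.mpr he) hγ
  refine ⟨(fundamentalGroupCongr H.toHomotopyEquiv _).trans Θ, (congrArg Θ ?_).trans hΘ⟩
  exact (fundamentalGroupCongr_apply _ _).trans (mapOfEq_mapOfEq (fun _ => rfl) _ _ _ γ)

end PuncturedTorusGroup

section Inversion

variable {V : Type*} [NormedAddCommGroup V] [NormedSpace ℝ V]

/-- The homeomorphism of a punctured normed space that inverts the norm and acts on directions by a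
homeomorphism `φ` of the unit sphere. -/
noncomputable def inversion (φ : Metric.sphere (0 : V) 1 ≃ₜ Metric.sphere (0 : V) 1) :
    ({0}ᶜ : Set V) ≃ₜ ({0}ᶜ : Set V) :=
  let invIoi : Set.Ioi (0 : ℝ) ≃ₜ Set.Ioi (0 : ℝ) :=
    { toFun := fun r => ⟨(r : ℝ)⁻¹, inv_pos.mpr r.2.out⟩
      invFun := fun r => ⟨(r : ℝ)⁻¹, inv_pos.mpr r.2.out⟩
      left_inv := fun _ => Subtype.ext (inv_inv _)
      right_inv := fun _ => Subtype.ext (inv_inv _)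
      continuous_toFun := (continuous_subtype_val.inv₀ fun r => r.2.out.ne').subtype_mk _
      continuous_invFun := (continuous_subtype_val.inv₀ fun r => r.2.out.ne').subtype_mk _ }
  (homeomorphUnitSphereProd V).trans
    ((φ.prodCongr invIoi).trans (homeomorphUnitSphereProd V).symm)

variable (φ : Metric.sphere (0 : V) 1 ≃ₜ Metric.sphere (0 : V) 1)

theorem coe_inversion (z : ({0}ᶜ : Set V)) :
    (inversion φ z : V) = ‖(z : V)‖⁻¹ • (φ (homeomorphUnitSphereProd V z).1 : V) := by
  change ((homeomorphUnitSphereProd V z).2 : ℝ)⁻¹ • _ = _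
  rw [homeomorphUnitSphereProd_apply_snd_coe]
  rfl

theorem norm_inversion (z : ({0}ᶜ : Set V)) : ‖(inversion φ z : V)‖ = ‖(z : V)‖⁻¹ := by
  rw [coe_inversion, norm_smul, norm_eq_of_mem_sphere, mul_one, norm_inv, norm_norm]

theorem inversion_of_mem_sphere {z : ({0}ᶜ : Set V)} (hz : (z : V) ∈ Metric.sphere (0 : V) 1) :
    (inversion φ z : V) = φ ⟨z, hz⟩ := by
  have hz₁ : ‖(z : V)‖ = 1 := mem_sphere_zero_iff_norm.mp hz
  have hdir : (homeomorphUnitSphereProd V z).1 = ⟨z, hz⟩ :=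
    Subtype.ext (by rw [homeomorphUnitSphereProd_apply_fst_coe, hz₁, inv_one, one_smul])
  rw [coe_inversion, hdir, hz₁, inv_one, one_smul]

end Inversion

namespace RegularBall

variable {n : ℕ} {X Y : Type*} [TopologicalSpace X] [TopologicalSpace Y]

theorem injective_coe (f : RegularBall n Y) :
    Function.Injective fun z : PuncturedSpace n => f.toFun z :=
  f.isOpenEmbedding.injective.comp Subtype.val_injective

theorem ne_center_of_mem_complement (e : RegularBall n X) {x : X} (hx : x ∈ e.complement) :
    x ≠ e.toFun 0 := by
  rintro rfl
  exact hx ⟨0, Metric.mem_ball_self one_pos, rfl⟩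

theorem apply_mem_complement_iff (e : RegularBall n X) {z : EuclideanSpace ℝ (Fin n)} :
    e.toFun z ∈ e.complement ↔ 1 ≤ ‖z‖ := by
  rw [complement, Set.mem_compl_iff, e.isOpenEmbedding.injective.mem_set_image,
    mem_ball_zero_iff, not_lt]

theorem mem_complement_of_notMem_range (e : RegularBall n X) {x : X}
    (hx : x ∉ Set.range e.toFun) : x ∈ e.complement :=
  fun h => hx (Set.image_subset_range _ _ h)

instance [CompactSpace X] (e : RegularBall n X) : CompactSpace e.complement :=
  isCompact_iff_compactSpace.mp
    (e.isOpenEmbedding.isOpenMap _ Metric.isOpen_ball).isClosed_compl.isCompact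

/-- The map `Y → X` that sends the punctured patch of `f` to the punctured patch of `e` by `χ` in
coordinates, and the rest of `Y` to the center of `e`. It is of interest when `χ` turns the patch
inside out, and its value at the center of `f` is then irrelevant. -/
noncomputable def collapse (e : RegularBall n X) (f : RegularBall n Y)
    (χ : PuncturedSpace n → PuncturedSpace n) :
    Y → X :=
  Function.extend (fun z : PuncturedSpace n => f.toFun z)
    (fun z => e.toFun (χ z)) fun _ => e.toFun 0

variable (e : RegularBall n X) (f : RegularBall n Y)
  {χ : PuncturedSpace n → PuncturedSpace n}

theorem collapse_apply (z : PuncturedSpace n) :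
    collapse e f χ (f.toFun z) = e.toFun (χ z) :=
  f.injective_coe.extend_apply _ _ z

theorem collapse_of_notMem_range {y : Y} (hy : y ∉ Set.range f.toFun) :
    collapse e f χ y = e.toFun 0 :=
  Function.extend_apply' _ _ _ fun ⟨z, hz⟩ => hy ⟨z, hz⟩

theorem continuousAt_collapse_apply (hχ : Continuous χ)
    (z : PuncturedSpace n) :
    ContinuousAt (collapse e f χ) (f.toFun z) := by
  have hf : IsOpenEmbedding fun z : PuncturedSpace n => f.toFun z :=
    f.isOpenEmbedding.comp isOpen_compl_singleton.isOpenEmbedding_subtypeVal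
  refine (hf.continuousAt_iff (x := z)).mp ?_
  have hcomp : (collapse e f χ ∘ fun z : PuncturedSpace n => f.toFun z) = fun z => e.toFun (χ z) :=
    funext (collapse_apply e f)
  rw [hcomp]
  exact (e.isOpenEmbedding.continuous.comp (continuous_subtype_val.comp hχ)).continuousAt

theorem continuousAt_collapse_of_notMem_range [T2Space Y] (hχ : ∀ z, ‖(χ z).1‖ = ‖z.1‖⁻¹) {y : Y}
    (hy : y ∉ Set.range f.toFun) : ContinuousAt (collapse e f χ) y := by
  intro O hO
  rw [collapse_of_notMem_range e f hy] at hO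
  obtain ⟨ε, hε, hball⟩ :=
    Metric.mem_nhds_iff.mp (e.isOpenEmbedding.continuous.continuousAt hO)
  have hclosed : IsClosed (f.toFun '' Metric.closedBall 0 ε⁻¹) :=
    ((isCompact_closedBall _ _).image f.isOpenEmbedding.continuous).isClosed
  rw [Filter.mem_map]
  filter_upwards [hclosed.isOpen_compl.mem_nhds fun h => hy (Set.image_subset_range _ _ h)]
    with y' hy'
  by_cases hz : ∃ z : PuncturedSpace n, f.toFun z = y'
  · obtain ⟨z, rfl⟩ := hz
    rw [Set.mem_preimage, collapse_apply]
    refine hball (mem_ball_zero_iff.mpr ?_)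
    rw [hχ]
    refine inv_lt_of_inv_lt₀ hε (not_le.mp fun h => hy' ?_)
    exact Set.mem_image_of_mem _ (mem_closedBall_zero_iff.mpr h)
  · rw [Set.mem_preimage, collapse, Function.extend_apply' _ _ _ hz]
    exact mem_of_mem_nhds hO

theorem continuousOn_collapse [T2Space Y] (hχ : Continuous χ) (hnorm : ∀ z, ‖(χ z).1‖ = ‖z.1‖⁻¹) :
    ContinuousOn (collapse e f χ) {f.toFun 0}ᶜ := by
  intro y hy
  refine ContinuousAt.continuousWithinAt ?_
  by_cases h : y ∈ Set.range f.toFun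
  · obtain ⟨z, rfl⟩ := h
    exact continuousAt_collapse_apply e f hχ ⟨z, fun hz => hy (congrArg f.toFun hz)⟩
  · exact continuousAt_collapse_of_notMem_range e f hnorm h

end RegularBall

/-- A map from a compact space to a Hausdorff space, seen as a homeomorphism over a set over which
it is bijective. -/
noncomputable def restrictPreimageHomeomorph {Q Z : Type*} [TopologicalSpace Q]
    [TopologicalSpace Z] [CompactSpace Q] [T2Space Z] (r : C(Q, Z)) {S : Set Z}
    (hr : Set.BijOn r (r ⁻¹' S) S) : r ⁻¹' S ≃ₜ S :=
  (Equiv.ofBijective (S.restrictPreimage r)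
    ⟨fun a b h => Subtype.ext (hr.injOn a.2 b.2 (congrArg Subtype.val h)), fun y =>
      let ⟨q, hq, h⟩ := hr.surjOn y.2
      ⟨⟨q, hq⟩, Subtype.ext h⟩⟩).toHomeomorphOfContinuousClosed
    r.continuous.restrictPreimage (r.continuous.isClosedMap.restrictPreimage S)

namespace GluedSum

open RegularBall

variable {n : ℕ} {X Y : Type*} [TopologicalSpace X] [TopologicalSpace Y]

/-- Connected sums are symmetric in their two summands. -/
def swap (e : RegularBall n X) (f : RegularBall n Y)
    (φ : Metric.sphere (0 : EuclideanSpace ℝ (Fin n)) 1 ≃ₜ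
      Metric.sphere (0 : EuclideanSpace ℝ (Fin n)) 1) :
    GluedSum e f φ ≃ₜ GluedSum f e φ.symm where
  toFun := Quot.lift (fun s => Quot.mk _ s.swap) fun _ _ ⟨z⟩ => by
    simpa using (Quot.sound (GlueRel.glue (e := f) (f := e) (φ := φ.symm) (φ z))).symm
  invFun := Quot.lift (fun s => Quot.mk _ s.swap) fun _ _ ⟨z⟩ => by
    simpa using (Quot.sound (GlueRel.glue (e := e) (f := f) (φ := φ) (φ.symm z))).symm
  left_inv := by rintro ⟨_ | _⟩ <;> rfl
  right_inv := by rintro ⟨_ | _⟩ <;> rfl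
  continuous_toFun := continuous_quot_lift _ (continuous_quot_mk.comp continuous_sum_swap)
  continuous_invFun := continuous_quot_lift _ (continuous_quot_mk.comp continuous_sum_swap)

variable (e : RegularBall n X) (f : RegularBall n Y)
  (φ : Metric.sphere (0 : EuclideanSpace ℝ (Fin n)) 1 ≃ₜ
    Metric.sphere (0 : EuclideanSpace ℝ (Fin n)) 1)

/-- The common punctured patch of the two summands: the coordinates of `e`, continued inside the
unit ball by the coordinates of `f` turned inside out. -/
noncomputable def patch (z : PuncturedSpace n) : GluedSum e f φ :=
  if h : 1 ≤ ‖(z : EuclideanSpace ℝ (Fin n))‖ then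
    Quot.mk _ (.inl ⟨e.toFun z, e.apply_mem_complement_iff.mpr h⟩)
  else Quot.mk _ (.inr ⟨f.toFun (inversion φ z), f.apply_mem_complement_iff.mpr <| by
    rw [norm_inversion]
    exact (one_le_inv₀ (norm_pos_iff.mpr z.2)).mpr (not_le.mp h).le⟩)

variable {z : PuncturedSpace n}

theorem patch_of_apply_mem (hz : e.toFun z ∈ e.complement) :
    patch e f φ z = Quot.mk _ (.inl ⟨e.toFun z, hz⟩) :=
  dif_pos (e.apply_mem_complement_iff.mp hz)

theorem patch_of_apply_inversion_mem (hz : f.toFun (inversion φ z) ∈ f.complement) :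
    patch e f φ z = Quot.mk _ (.inr ⟨f.toFun (inversion φ z), hz⟩) := by
  have hz₁ := f.apply_mem_complement_iff.mp hz
  rw [norm_inversion, one_le_inv₀ (norm_pos_iff.mpr z.2)] at hz₁
  rcases hz₁.lt_or_eq with h | h
  · exact dif_neg h.not_ge
  · have hS := mem_sphere_zero_iff_norm.mpr h
    rw [patch_of_apply_mem e f φ (e.apply_mem_complement_iff.mpr h.ge)]
    have hb : f.boundary (φ ⟨z, hS⟩) = ⟨f.toFun (inversion φ z), hz⟩ :=
      Subtype.ext (congrArg f.toFun (inversion_of_mem_sphere φ hS).symm)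
    exact hb ▸ Quot.sound (GlueRel.glue ⟨z.1, hS⟩)

theorem swap_patch (z : PuncturedSpace n) :
    swap e f φ (patch e f φ z) = patch f e φ.symm (inversion φ z) := by
  by_cases hz : 1 ≤ ‖z.1‖
  · have hz' := e.apply_mem_complement_iff.mpr hz
    have hinv : inversion φ.symm (inversion φ z) = z := (inversion φ).symm_apply_apply z
    rw [patch_of_apply_mem e f φ hz', patch_of_apply_inversion_mem f e φ.symm (by rwa [hinv])]
    simp only [hinv]
    rfl
  · have hz' : f.toFun (inversion φ z) ∈ f.complement := by
      rw [apply_mem_complement_iff, norm_inversion]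
      exact (one_le_inv₀ (norm_pos_iff.mpr z.2)).mpr (not_le.mp hz).le
    rw [patch_of_apply_inversion_mem e f φ hz', patch_of_apply_mem f e φ.symm hz']
    rfl

theorem exists_eq (q : GluedSum e f φ) :
    (∃ x, ∃ hx : x ∉ Set.range e.toFun,
      q = Quot.mk _ (.inl ⟨x, e.mem_complement_of_notMem_range hx⟩)) ∨
    (∃ y, ∃ hy : y ∉ Set.range f.toFun,
      q = Quot.mk _ (.inr ⟨y, f.mem_complement_of_notMem_range hy⟩)) ∨
    ∃ z, q = patch e f φ z := by
  obtain ⟨⟨x, hx⟩ | ⟨y, hy⟩⟩ := q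
  · by_cases h : x ∈ Set.range e.toFun
    · obtain ⟨z, rfl⟩ := h
      have hz : z ≠ 0 := fun h₀ => e.ne_center_of_mem_complement hx (congrArg e.toFun h₀)
      exact .inr (.inr ⟨⟨z, hz⟩, (patch_of_apply_mem e f φ (z := ⟨z, hz⟩) hx).symm⟩)
    · exact .inl ⟨x, h, rfl⟩
  · by_cases h : y ∈ Set.range f.toFun
    · obtain ⟨z, rfl⟩ := h
      have hz : z ≠ 0 := fun h₀ => f.ne_center_of_mem_complement hy (congrArg f.toFun h₀)
      obtain ⟨v, hv⟩ := (inversion φ).surjective ⟨z, hz⟩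
      obtain rfl : inversion φ v = z := congrArg Subtype.val hv
      exact .inr (.inr ⟨v, (patch_of_apply_inversion_mem e f φ hy).symm⟩)
    · exact .inr (.inl ⟨y, h, rfl⟩)

/-- The map from the glued space to the first summand that fills the removed ball by the second
summand turned inside out. -/
noncomputable def toLeft [T2Space Y] : C(GluedSum e f φ, X) where
  toFun := Quot.lift (Sum.elim Subtype.val fun y => collapse e f (inversion φ).symm y) <| by
    rintro _ _ ⟨u⟩
    let z : PuncturedSpace n := ⟨u, ne_zero_of_mem_unit_sphere u⟩
    have hu : (φ u : EuclideanSpace ℝ (Fin n)) = inversion φ z :=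
      (inversion_of_mem_sphere φ (z := z) u.2).symm
    change e.toFun z = collapse e f (inversion φ).symm (f.toFun (φ u))
    rw [hu, collapse_apply, Homeomorph.symm_apply_apply]
  continuous_toFun := continuous_quot_lift _ <| continuous_subtype_val.sumElim <|
    (continuousOn_collapse e f (inversion φ).symm.continuous
      (norm_inversion φ.symm)).comp_continuous continuous_subtype_val
      fun y => f.ne_center_of_mem_complement y.2

section ToLeft

variable [T2Space Y]

theorem toLeft_inr_of_notMem_range {y : Y} (hy : y ∉ Set.range f.toFun) :
    toLeft e f φ (Quot.mk _ (.inr ⟨y, f.mem_complement_of_notMem_range hy⟩)) = e.toFun 0 :=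
  collapse_of_notMem_range e f hy

theorem toLeft_patch (z : PuncturedSpace n) :
    toLeft e f φ (patch e f φ z) = e.toFun z := by
  rw [patch]
  split_ifs
  · rfl
  · exact (collapse_apply e f _).trans (by rw [Homeomorph.symm_apply_apply])

theorem injOn_toLeft : Set.InjOn (toLeft e f φ) (toLeft e f φ ⁻¹' {e.toFun 0}ᶜ) := by
  intro q hq q' hq' h
  obtain ⟨x, hx, rfl⟩ | ⟨y, hy, rfl⟩ | ⟨z, rfl⟩ := exists_eq e f φ q
  · obtain ⟨x', hx', rfl⟩ | ⟨y', hy', rfl⟩ | ⟨z', rfl⟩ := exists_eq e f φ q'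
    · obtain rfl : x = x' := h
      rfl
    · exact absurd (toLeft_inr_of_notMem_range e f φ hy') hq'
    · exact absurd ⟨z'.1, (toLeft_patch e f φ z').symm.trans h.symm⟩ hx
  · exact absurd (toLeft_inr_of_notMem_range e f φ hy) hq
  · obtain ⟨x', hx', rfl⟩ | ⟨y', hy', rfl⟩ | ⟨z', rfl⟩ := exists_eq e f φ q'
    · exact absurd ⟨z.1, (toLeft_patch e f φ z).symm.trans h⟩ hx'
    · exact absurd (toLeft_inr_of_notMem_range e f φ hy') hq'
    · rw [toLeft_patch, toLeft_patch] at h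
      rw [e.injective_coe h]

theorem exists_toLeft_eq {x : X} (hx : x ≠ e.toFun 0) :
    ∃ q : GluedSum e f φ, toLeft e f φ q = x := by
  by_cases h : x ∈ e.complement
  · exact ⟨Quot.mk _ (.inl ⟨x, h⟩), rfl⟩
  · obtain ⟨z, -, rfl⟩ := not_not.mp h
    exact ⟨patch e f φ ⟨z, fun h₀ => hx (congrArg e.toFun h₀)⟩, toLeft_patch e f φ _⟩

theorem bijOn_toLeft :
    Set.BijOn (toLeft e f φ) (toLeft e f φ ⁻¹' {e.toFun 0}ᶜ) {e.toFun 0}ᶜ := by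
  refine ⟨Set.mapsTo_preimage _ _, injOn_toLeft e f φ, fun x hx => ?_⟩
  obtain ⟨q, rfl⟩ := exists_toLeft_eq e f φ hx
  exact ⟨q, hx, rfl⟩

end ToLeft

variable [CompactSpace X] [CompactSpace Y] [T2Space X] [T2Space Y]

/-- The first summand without its center, as a subspace of the glued space: the first summand with
its ball removed, enlarged by the punctured patch of the second summand turned inside out. -/
noncomputable def leftInclusion : C(({e.toFun 0}ᶜ : Set X), GluedSum e f φ) where
  toFun x := ((restrictPreimageHomeomorph (toLeft e f φ) (bijOn_toLeft e f φ)).symm x).1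
  continuous_toFun := continuous_subtype_val.comp (Homeomorph.continuous _)

theorem toLeft_leftInclusion (x : ({e.toFun 0}ᶜ : Set X)) :
    toLeft e f φ (leftInclusion e f φ x) = x :=
  congrArg Subtype.val
    ((restrictPreimageHomeomorph (toLeft e f φ) (bijOn_toLeft e f φ)).apply_symm_apply x)

theorem leftInclusion_eq {x : ({e.toFun 0}ᶜ : Set X)} {q : GluedSum e f φ}
    (h : toLeft e f φ q = x) : leftInclusion e f φ x = q :=
  injOn_toLeft e f φ (by rw [Set.mem_preimage, toLeft_leftInclusion]; exact x.2)
    (by rw [Set.mem_preimage, h]; exact x.2) (by rw [h, toLeft_leftInclusion])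

theorem isOpenEmbedding_leftInclusion : IsOpenEmbedding (leftInclusion e f φ) :=
  (isOpen_compl_singleton.preimage (toLeft e f φ).continuous).isOpenEmbedding_subtypeVal.comp
    (restrictPreimageHomeomorph (toLeft e f φ) (bijOn_toLeft e f φ)).symm.isOpenEmbedding

/-- The second summand without its center, as a subspace of the glued space. -/
noncomputable def rightInclusion : C(({f.toFun 0}ᶜ : Set Y), GluedSum e f φ) where
  toFun y := (swap e f φ).symm (leftInclusion f e φ.symm y)
  continuous_toFun := (swap e f φ).symm.continuous.comp (leftInclusion f e φ.symm).continuous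

theorem leftInclusion_punctured (z : PuncturedSpace n) :
    leftInclusion e f φ (e.punctured rfl z) = patch e f φ z :=
  leftInclusion_eq e f φ (toLeft_patch e f φ z)

theorem rightInclusion_punctured_inversion (z : PuncturedSpace n) :
    rightInclusion e f φ (f.punctured rfl (inversion φ z)) = patch e f φ z := by
  refine (swap e f φ).symm_apply_eq.mpr ?_
  rw [leftInclusion_punctured, swap_patch]

theorem mem_range_punctured_of_leftInclusion_eq {x : ({e.toFun 0}ᶜ : Set X)}
    {y : ({f.toFun 0}ᶜ : Set Y)} (h : leftInclusion e f φ x = rightInclusion e f φ y) :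
    x ∈ Set.range (e.punctured rfl) := by
  by_contra hx
  have hx' : x.1 ∉ Set.range e.toFun := by
    rintro ⟨z, hz⟩
    exact hx ⟨⟨z, fun h₀ => x.2 (hz.symm.trans (congrArg e.toFun h₀))⟩, Subtype.ext hz⟩
  have hq : leftInclusion e f φ x =
      Quot.mk _ (.inl ⟨x, e.mem_complement_of_notMem_range hx'⟩) := leftInclusion_eq e f φ rfl
  have hy : leftInclusion f e φ.symm y =
      Quot.mk _ (.inr ⟨x, e.mem_complement_of_notMem_range hx'⟩) :=
    (swap e f φ).symm_apply_eq.mp (h.symm.trans hq)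
  refine y.2 ?_
  rw [← toLeft_leftInclusion f e φ.symm y, hy]
  exact toLeft_inr_of_notMem_range f e φ.symm hx'

theorem isOpenSquare : IsOpenSquare (leftInclusion e f φ) (rightInclusion e f φ)
    (e.punctured rfl) ((f.punctured rfl).comp (inversion φ : C(_, _))) where
  isOpenEmbedding_left := isOpenEmbedding_leftInclusion e f φ
  isOpenEmbedding_right :=
    (swap e f φ).symm.isOpenEmbedding.comp (isOpenEmbedding_leftInclusion f e φ.symm)
  isEmbedding := (e.isOpenEmbedding_punctured rfl).isEmbedding
  comm z := (leftInclusion_punctured e f φ z).trans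
    (rightInclusion_punctured_inversion e f φ z).symm
  cover := by
    rintro ⟨x | y⟩
    · exact .inl ⟨⟨x, e.ne_center_of_mem_complement x.2⟩, leftInclusion_eq e f φ rfl⟩
    · exact .inr ⟨⟨y, f.ne_center_of_mem_complement y.2⟩,
        (swap e f φ).symm_apply_eq.mpr (leftInclusion_eq f e φ.symm rfl)⟩
  overlap := mem_range_punctured_of_leftInclusion_eq e f φ

end GluedSum

section Pushout

variable {X Y₁ Y₂ W P : Type*} [TopologicalSpace X] [TopologicalSpace Y₁] [TopologicalSpace Y₂]
  [TopologicalSpace W] [Group P] {j₁ : C(Y₁, X)} {j₂ : C(Y₂, X)} {k₁ : C(W, Y₁)} {k₂ : C(W, Y₂)}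

theorem monoidHom_eq_of_range_sup_range {G H K L : Type*} [Group G] [Group H] [Group K] [Group L]
    {i : G →* K} {j : H →* K} (hK : i.range ⊔ j.range = ⊤) {a b : K →* L}
    (hi : a.comp i = b.comp i) (hj : a.comp j = b.comp j) : a = b := by
  rw [Subgroup.sup_eq_closure] at hK
  refine MonoidHom.eq_of_eqOn_dense hK ?_
  rintro _ (⟨x, rfl⟩ | ⟨x, rfl⟩)
  exacts [DFunLike.congr_fun hi x, DFunLike.congr_fun hj x]

theorem IsOpenSquare.nonempty_mulEquiv [PathConnectedSpace Y₁] [PathConnectedSpace Y₂]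
    [PathConnectedSpace W] (h : IsOpenSquare j₁ j₂ k₁ k₂) {w : W}
    {i₁ : FundamentalGroup Y₁ (k₁ w) →* P} {i₂ : FundamentalGroup Y₂ (k₂ w) →* P}
    (hW : i₁.comp (FundamentalGroup.mapOfEq k₁ rfl) = i₂.comp (FundamentalGroup.mapOfEq k₂ rfl))
    (hP : i₁.range ⊔ i₂.range = ⊤) {r : P →* FundamentalGroup X (j₁ (k₁ w))}
    (hr₁ : r.comp i₁ = FundamentalGroup.mapOfEq j₁ rfl)
    (hr₂ : r.comp i₂ = FundamentalGroup.mapOfEq j₂ (h.comm w).symm) :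
    Nonempty (FundamentalGroup X (j₁ (k₁ w)) ≃* P) := by
  obtain ⟨Φ, rfl, rfl⟩ := h.exists_cocycle i₁ i₂ hW
  have hΦ₁ : (Φ.hom _).comp (FundamentalGroup.mapOfEq j₁ rfl) = (Φ.comap j₁).hom (k₁ w) :=
    MonoidHom.ext (Φ.hom_mapOfEq j₁ rfl)
  have hΦ₂ : (Φ.hom _).comp (FundamentalGroup.mapOfEq j₂ (h.comm w).symm) =
      (Φ.comap j₂).hom (k₂ w) := MonoidHom.ext (Φ.hom_mapOfEq j₂ (h.comm w).symm)
  exact ⟨(Φ.hom _).toMulEquiv r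
    (monoidHom_eq_of_range_sup_range (h.range_sup_range w)
      (by rw [MonoidHom.comp_assoc, hΦ₁, hr₁, MonoidHom.id_comp])
      (by rw [MonoidHom.comp_assoc, hΦ₂, hr₂, MonoidHom.id_comp]))
    (monoidHom_eq_of_range_sup_range hP
      (by rw [MonoidHom.comp_assoc, hr₁, hΦ₁, MonoidHom.id_comp])
      (by rw [MonoidHom.comp_assoc, hr₂, hΦ₂, MonoidHom.id_comp]))⟩

end Pushout

section TwoHoledGroup

/-- The homomorphism from the free group on two letters to the surface group that hits the first
handle: `true` goes to `β₁` and `false` to `α₁`. -/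
def firstHandle : FreeGroup Bool →* PresentedGroup {twoHoledRelator} :=
  FreeGroup.lift fun b => cond b (PresentedGroup.of .β₁) (PresentedGroup.of .α₁)

/-- The homomorphism from the free group on two letters to the surface group that hits the second
handle: `true` goes to `α₂` and `false` to `β₂`. The order is the opposite of the one in
`firstHandle` because the relator makes the commutators of the two handles inverse to each other. -/
def secondHandle : FreeGroup Bool →* PresentedGroup {twoHoledRelator} :=
  FreeGroup.lift fun b => cond b (PresentedGroup.of .α₂) (PresentedGroup.of .β₂)

theorem firstHandle_commutator_eq_secondHandle_commutator :
    firstHandle ⁅FreeGroup.of true, FreeGroup.of false⁆ =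
      secondHandle ⁅FreeGroup.of true, FreeGroup.of false⁆ := by
  let x : TwoHoledGen → PresentedGroup {twoHoledRelator} := PresentedGroup.of
  have h : ⁅x .β₁, x .α₁⁆ * ⁅x .β₂, x .α₂⁆ = 1 :=
    PresentedGroup.one_of_mem (Set.mem_singleton _)
  rw [mul_eq_one_iff_eq_inv, commutatorElement_inv] at h
  simpa only [firstHandle, secondHandle, map_commutatorElement, FreeGroup.lift_apply_of, cond_true,
    cond_false] using h

theorem range_firstHandle_sup_range_secondHandle :
    firstHandle.range ⊔ secondHandle.range = ⊤ := by
  refine top_unique ((PresentedGroup.closure_range_of _).ge.trans ((Subgroup.closure_le _).mpr ?_))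
  rintro _ ⟨_ | _, rfl⟩
  · exact Subgroup.mem_sup_left ⟨.of false, by simp [firstHandle]⟩
  · exact Subgroup.mem_sup_left ⟨.of true, by simp [firstHandle]⟩
  · exact Subgroup.mem_sup_right ⟨.of true, by simp [secondHandle]⟩
  · exact Subgroup.mem_sup_right ⟨.of false, by simp [secondHandle]⟩

theorem exists_comp_firstHandle_comp_secondHandle {G : Type*} [Group G] {i j : FreeGroup Bool →* G}
    (h : i ⁅FreeGroup.of true, FreeGroup.of false⁆ = j ⁅FreeGroup.of true, FreeGroup.of false⁆) :
    ∃ r : PresentedGroup {twoHoledRelator} →* G,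
      r.comp firstHandle = i ∧ r.comp secondHandle = j := by
  let image : TwoHoledGen → G
    | .α₁ => i (.of false)
    | .β₁ => i (.of true)
    | .α₂ => j (.of true)
    | .β₂ => j (.of false)
  have himage : ∀ x ∈ ({twoHoledRelator} : Set (FreeGroup TwoHoledGen)),
      FreeGroup.lift image x = 1 := by
    rintro _ rfl
    have hcomm : ⁅image .β₁, image .α₁⁆ * ⁅image .β₂, image .α₂⁆ = 1 := by
      rw [mul_eq_one_iff_eq_inv, commutatorElement_inv]
      simpa only [map_commutatorElement] using h
    simpa [twoHoledRelator, commutatorElement_def] using hcomm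
  refine ⟨PresentedGroup.toGroup himage, ?_, ?_⟩ <;> ext b <;> cases b <;>
    simp [firstHandle, secondHandle, image]

end TwoHoledGroup

section TwoHoledTorus

instance (p : Torus) : PathConnectedSpace ({p}ᶜ : Set Torus) :=
  let H : ({p}ᶜ : Set Torus) ≃ₜ PuncturedTorus :=
    (Homeomorph.subRight p).subtype fun _ => sub_ne_zero.symm
  H.symm.surjective.pathConnectedSpace H.symm.continuous

theorem IsOpenSquare.nonempty_mulEquiv_presentedGroup {X Y₁ Y₂ W : Type*} [TopologicalSpace X]
    [TopologicalSpace Y₁] [TopologicalSpace Y₂] [TopologicalSpace W] [PathConnectedSpace Y₁]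
    [PathConnectedSpace Y₂] [PathConnectedSpace W] {j₁ : C(Y₁, X)} {j₂ : C(Y₂, X)} {k₁ : C(W, Y₁)}
    {k₂ : C(W, Y₂)} (h : IsOpenSquare j₁ j₂ k₁ k₂) {w : W} {γ : FundamentalGroup W w}
    (hγ : Subgroup.zpowers γ = ⊤)
    (Θ₁ : FundamentalGroup Y₁ (k₁ w) ≃* FreeGroup Bool)
    (hΘ₁ : Θ₁ (FundamentalGroup.mapOfEq k₁ rfl γ) = ⁅FreeGroup.of true, FreeGroup.of false⁆)
    (Θ₂ : FundamentalGroup Y₂ (k₂ w) ≃* FreeGroup Bool)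
    (hΘ₂ : Θ₂ (FundamentalGroup.mapOfEq k₂ rfl γ) = ⁅FreeGroup.of true, FreeGroup.of false⁆) :
    Nonempty (FundamentalGroup X (j₁ (k₁ w)) ≃* PresentedGroup {twoHoledRelator}) := by
  have hγ₁₂ : FundamentalGroup.mapOfEq j₁ rfl (FundamentalGroup.mapOfEq k₁ rfl γ) =
      FundamentalGroup.mapOfEq j₂ (h.comm w).symm (FundamentalGroup.mapOfEq k₂ rfl γ) :=
    (mapOfEq_mapOfEq (k := j₁.comp k₁) (fun _ => rfl) _ _ rfl γ).trans
      (mapOfEq_mapOfEq (fun x => (h.comm x).symm) _ _ _ γ).symm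
  rw [← Θ₁.eq_symm_apply] at hΘ₁
  rw [← Θ₂.eq_symm_apply] at hΘ₂
  rw [hΘ₁, hΘ₂] at hγ₁₂
  obtain ⟨r, hr₁, hr₂⟩ := exists_comp_firstHandle_comp_secondHandle
    (i := (FundamentalGroup.mapOfEq j₁ rfl).comp Θ₁.symm.toMonoidHom)
    (j := (FundamentalGroup.mapOfEq j₂ (h.comm w).symm).comp Θ₂.symm.toMonoidHom) hγ₁₂
  refine h.nonempty_mulEquiv (i₁ := firstHandle.comp Θ₁.toMonoidHom)
    (i₂ := secondHandle.comp Θ₂.toMonoidHom) ?_ ?_ (r := r) ?_ ?_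
  · rw [Subgroup.zpowers_eq_closure] at hγ
    refine MonoidHom.eq_of_eqOn_dense hγ (Set.eqOn_singleton.mpr ?_)
    simpa [hΘ₁, hΘ₂] using firstHandle_commutator_eq_secondHandle_commutator
  · rw [MonoidHom.range_comp, MonoidHom.range_comp, MonoidHom.range_eq_top.mpr Θ₁.surjective,
      MonoidHom.range_eq_top.mpr Θ₂.surjective, ← MonoidHom.range_eq_map, ← MonoidHom.range_eq_map]
    exact range_firstHandle_sup_range_secondHandle
  · rw [← MonoidHom.comp_assoc, hr₁]
    ext x
    simp
  · rw [← MonoidHom.comp_assoc, hr₂]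
    ext x
    simp

variable (e f : RegularBall 2 Torus)
  (φ : Metric.sphere (0 : EuclideanSpace ℝ (Fin 2)) 1 ≃ₜ
    Metric.sphere (0 : EuclideanSpace ℝ (Fin 2)) 1)

theorem nonempty_mulEquiv_gluedSum (x : GluedSum e f φ) :
    Nonempty (FundamentalGroup (GluedSum e f φ) x ≃* PresentedGroup {twoHoledRelator}) := by
  have hsquare := GluedSum.isOpenSquare e f φ
  have := hsquare.pathConnectedSpace
  obtain ⟨γ, hγ⟩ : ∃ γ : FundamentalGroup PuncturedPlane diagonalPoint, Subgroup.zpowers γ = ⊤ :=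
    ⟨_, zpowers_circleLoop diagonalPoint⟩
  obtain ⟨Θ₁, hΘ₁⟩ := exists_mulEquiv_compl_singleton e rfl hγ
  obtain ⟨Θ₂, hΘ₂⟩ := exists_mulEquiv_compl_singleton f rfl
    (zpowers_mapOfEq_eq_top (inversion φ).toHomotopyEquiv hγ)
  obtain ⟨Θ⟩ := hsquare.nonempty_mulEquiv_presentedGroup hγ Θ₁ hΘ₁ Θ₂ <|
    (congrArg Θ₂ (mapOfEq_mapOfEq (fun _ => rfl) _ _ _ γ).symm).trans hΘ₂
  exact ⟨(FundamentalGroup.fundamentalGroupMulEquivOfPathConnected _ _).trans Θ⟩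

end TwoHoledTorus

theorem mainTheorem3 (M : Type*) [TopologicalSpace M] (hM : IsConnectedSum 2 M Torus Torus)
    (x₀ : M) :
    Nonempty (FundamentalGroup M x₀ ≃* PresentedGroup {twoHoledRelator}) := by
  obtain ⟨e, f, φ, ⟨H⟩⟩ := hM
  obtain ⟨Θ⟩ := nonempty_mulEquiv_gluedSum e f φ (H x₀)
  exact ⟨(fundamentalGroupCongr H.toHomotopyEquiv x₀).trans Θ⟩
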